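/- Consider the deterministic Massively Parallel Computation (MPC) model: there are $M$ machines, each with a local memory of $\mathcal S$ words, a word being an $O(\log n)$-bit number; the global space is $\mathcal S_{\mathcal G}=\mathcal S\cdot M$. A computation proceeds in synchronous rounds; in each round every machine performs an arbitrary (unbounded, deterministic) local computation on the content of its memory and sends words to machines of its choice, and the words that a machine sends, those that it receives, and those that it holds at any time must each fit into $\mathcal S$ words. The input, an undirected graph $G=(V,E)$ with $n=|V|$ and $m=|E|$ whose vertices carry distinct natural numbers bounded by a fixed polynomial in $n$ as IDs, is initially distributed arbitrarily among the machines (one word for each vertex and for each edge), subject to the local space. The program may depend on $n$ and $m$. Contracting a vertex $u$ into an adjacent vertex $v$ means removing $u$, replacing every edge $\{u,x\}$ by $\{v,x\}$, and discarding the resulting loops and parallel edges. A sequence of contractions of edges of $G$ is called independent if, whenever a vertex is contracted into a vertex $u$, the vertex $u$ is not itself contracted into another vertex. **Theorem.** Let $\delta>0$ be an arbitrary constant. There is a deterministic MPC algorithm with local space $\mathcal S=O(|V|^{\delta})$ and global space $\mathcal S_{\mathcal G}=O(|V|+|E|)$ that, for every undirected simple graph $G=(V,E)$ with no isolated vertices,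 constructs in $O(1)$ rounds an undirected simple graph $G^*=(V^*,E^*)$, left distributed among the machines, such that - $G^*$ is obtained from $G$ by a sequence of independent contractions of edges of $G$, and - $|V^*|\le \frac{99}{100}\,|V|$. The constants hidden in $O(\cdot)$ depend only on $\delta$ and on the exponent of the polynomial that bounds the IDs. -/

import Mathlib

/-- A finite undirected simple graph whose vertices are identified with natural numbers (IDs). -/
structure FinGraph where
  verts : Finset ℕ
  graph : SimpleGraph ℕ
  support_subset : ∀ u v : ℕ, graph.Adj u v → u ∈ verts

namespace FinGraph

/-- The finite set `E` of edges. -/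
noncomputable def edges (G : FinGraph) : Finset (Sym2 ℕ) := by
  classical
  exact G.verts.sym2.filter (fun e => e ∈ G.graph.edgeSet)

theorem mem_edges (G : FinGraph) (e : Sym2 ℕ) : e ∈ G.edges ↔ e ∈ G.graph.edgeSet := by
  classical
  induction e using Sym2.ind with
  | _ u v =>
    simp only [edges, Finset.mem_filter, Finset.mk_mem_sym2_iff, SimpleGraph.mem_edgeSet,
      and_iff_right_iff_imp]
    intro h
    exact ⟨G.support_subset u v h, G.support_subset v u h.symm⟩

/-- The number `n = |V|` of vertices. -/
def n (G : FinGraph) : ℕ := G.verts.card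

/-- The number `m = |E|` of edges. -/
noncomputable def m (G : FinGraph) : ℕ := G.edges.card

/-- Every vertex has a neighbour. -/
def NoIsolated (G : FinGraph) : Prop := ∀ u ∈ G.verts, ∃ v, G.graph.Adj u v

/-- Contraction of the vertex `u` into its neighbour `v`: the vertex `u` is removed, every edge
`{u, x}` is replaced by `{v, x}`, and loops and parallel edges are discarded
(`SimpleGraph.map` pushes the adjacency relation forward and drops loops). -/
def contract (G : FinGraph) (u v : ℕ) (h : G.graph.Adj u v) : FinGraph where
  verts := G.verts.erase u
  graph := G.graph.map (fun x => if x = u then v else x)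
  support_subset := by
    intro a b hab
    rw [SimpleGraph.map_adj'] at hab
    obtain ⟨-, x, y, hxy, hxa, -⟩ := hab
    rw [Finset.mem_erase]
    split_ifs at hxa with hx
    · subst hxa
      exact ⟨h.ne', G.support_subset _ _ h.symm⟩
    · subst hxa
      exact ⟨hx, G.support_subset _ _ hxy⟩

/-- `ContractsTo G L H`: performing one after the other the contractions listed in `L`, where
the pair `(u, v)` stands for contracting `u` into its current neighbour `v`, turns `G` into `H`. -/
inductive ContractsTo : FinGraph → List (ℕ × ℕ) → FinGraph → Prop
  | nil (G : FinGraph) : ContractsTo G [] G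
  | cons {G H : FinGraph} {u v : ℕ} {L : List (ℕ × ℕ)} (h : G.graph.Adj u v) :
      ContractsTo (G.contract u v h) L H → ContractsTo G ((u, v) :: L) H

/-- `H` is obtained from `G` by a sequence of independent contractions of edges of `G`: if a
vertex is contracted into `u`, then `u` itself is not contracted into any vertex. -/
def IndependentContraction (G H : FinGraph) : Prop :=
  ∃ L : List (ℕ × ℕ),
    (∀ p ∈ L, G.graph.Adj p.1 p.2) ∧
    (∀ p ∈ L, ∀ q ∈ L, q.1 ≠ p.2) ∧
    ContractsTo G L H

/-- The description of a graph as a collection of words, one for each vertex and one for each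
edge: the vertex `u` is the word `⟨u, u⟩` and the edge `{u, v}` with `u < v` is the word `⟨u, v⟩`,
where `⟨·, ·⟩` is the pairing function `Nat.pair`. -/
noncomputable def encode (G : FinGraph) : Multiset ℕ :=
  G.verts.val.map (fun u => Nat.pair u u) +
    G.edges.val.map (fun e => Nat.pair e.inf e.sup)

end FinGraph

/-- A deterministic MPC program. The content of the local memory of a machine is a collection of
words; a word is a natural number. In round `r` the machine `i`, holding the collection `s`,
performs an arbitrary local computation and sends the messages `step r i s`; the message `(j, w)`
delivers the word `w` to the machine `j`. A machine keeps a word by sending it to itself. -/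
structure MPCProgram where
  /-- number of machines -/
  machines : ℕ
  /-- local space of each machine, in words -/
  space : ℕ
  /-- local computation, and the messages it sends -/
  step : ℕ → Fin machines → Multiset ℕ → Multiset (Fin machines × ℕ)

namespace MPCProgram

/-- The global space: the total local space of all machines. -/
def globalSpace (P : MPCProgram) : ℕ := P.space * P.machines

/-- The content of the memories after the first `r` rounds. -/
def memory (P : MPCProgram) (init : Fin P.machines → Multiset ℕ) :
    ℕ → Fin P.machines → Multiset ℕ
  | 0 => init
  | r + 1 => fun j =>
      ∑ i, ((P.step r i (P.memory init r i)).filter (fun msg => msg.1 = j)).map Prod.snd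

/-- The computation with initial memories `init` obeys the constraints of the model for `R` rounds
with words smaller than `W`: in each round no machine sends more than `space` words, and at all
times no machine holds more than `space` words (so none receives more), all smaller than `W`. -/
def Obeys (P : MPCProgram) (init : Fin P.machines → Multiset ℕ) (R W : ℕ) : Prop :=
  (∀ r < R, ∀ i, (P.step r i (P.memory init r i)).card ≤ P.space) ∧
  (∀ r ≤ R, ∀ i, (P.memory init r i).card ≤ P.space) ∧
  (∀ r ≤ R, ∀ i, ∀ w ∈ P.memory init r i, w < W)

/-- `init` is a distribution of the words `I` among the machines that fits their local space. -/
def IsDistribution (P : MPCProgram) (init : Fin P.machines → Multiset ℕ) (I : Multiset ℕ) : Prop :=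
  ∑ i, init i = I ∧ ∀ i, (init i).card ≤ P.space

end MPCProgram

/-! Every vertex `u` singles out its least neighbour `ℓ(u)`. Given a bipartition `c` of the IDs,
contract each `u` on the `true` side whose `ℓ(u)` lies on the `false` side into `ℓ(u)`. A vertex
that receives a contraction is on the `false` side, so it is not contracted itself, and independence
is automatic. A uniformly random `c` moves a quarter of the vertices in expectation.

The randomness is removed by a fixed family of `Q` bipartitions in which every ordered pair of
distinct IDs is separated in the right direction by at least `Q / 100` members
(`exists_hash_family`). Averaging over the family, some member moves at least `n / 100` vertices
(`card_le_card_moved`). The family depends only on the ID bound and on `Q`, so it is part of the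
program. It suffices that `2 ^ Q` exceeds a fixed power of `n`; here `Q` is a constant multiple of
`b`, where `b` is about `n ^ (1 / q)`, so that the `Q` counts of moved vertices can be formed
simultaneously.

The communication rests on one primitive, `superround`: a tree of fan-in `b` and constant depth
gives every machine the sums of `Q` counters over all machines and over the machines to its left,
after which data are routed. With counts as values, one such pass is a stable counting sort
(`sort_pass`), and constantly many passes are a radix sort, because keys are polynomial in `n` and
`Q` is at least `b`. With maxima as values, a pass over sorted data tells each item the minimum of
its group (`Stored.annotate`) or discards repetitions (`Stored.dedup`). `contraction_reach` combines
these: the edges become arcs, each arc learns the least neighbours of both ends, the best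
bipartition is selected, the arcs are replaced by the words of the contracted graph, and repetitions
are removed.

Programs are not written explicitly. All admissible inputs are treated simultaneously as scenarios
`ω : Ω`, and a round is a transition between families of memories. It is legitimate as soon as each
machine's messages are determined by its own memory (`MPCStep.of_known`); `Reach.realize` turns a
chain of such rounds into a program. -/

/-! ### Message delivery and rounds over a family of scenarios -/

/-- The words delivered to the machine `j`. -/
def deliver {M : ℕ} (msg : Fin M → Multiset (Fin M × ℕ)) (j : Fin M) : Multiset ℕ :=
  ∑ i, ((msg i).filter (fun x => x.1 = j)).map Prod.snd

theorem deliver_add {M : ℕ} (f g : Fin M → Multiset (Fin M × ℕ)) (j : Fin M) :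
    deliver (fun i => f i + g i) j = deliver f j + deliver g j := by
  simp [deliver, Finset.sum_add_distrib]

theorem filter_map_mk {M : ℕ} (i j : Fin M) (s : Multiset ℕ) :
    ((s.map (fun w => (i, w))).filter (fun x => x.1 = j)).map Prod.snd = if i = j then s else 0 := by
  rw [Multiset.filter_map]
  split_ifs with h
  · simp [h]
  · simp [h]

theorem deliver_dest {M : ℕ} (dest : Fin M → Fin M) (s : Fin M → Multiset ℕ) (j : Fin M) :
    deliver (fun i => (s i).map (fun w => (dest i, w))) j =
      ∑ i ∈ Finset.univ.filter (fun i => dest i = j), s i := by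
  simp only [deliver, filter_map_mk, Finset.sum_filter]

theorem deliver_self {M : ℕ} (s : Fin M → Multiset ℕ) (j : Fin M) :
    deliver (fun i => (s i).map (fun w => (i, w))) j = s j := by
  refine (deliver_dest id s j).trans ?_
  simp [Finset.filter_eq']

theorem filter_map_sum {ι M : Type*} [DecidableEq M] (t : Finset ι) (f : ι → Multiset (M × ℕ)) (j : M) :
    ((∑ g ∈ t, f g).filter (fun x => x.1 = j)).map Prod.snd =
      ∑ g ∈ t, ((f g).filter (fun x => x.1 = j)).map Prod.snd := by
  classical
  induction t using Finset.induction_on with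
  | empty => simp
  | insert a t ha ih => simp [Finset.sum_insert ha, Multiset.filter_add, ih]

/-- Each machine `g` has exactly one sender `src g`, so nothing is lost or duplicated. This is the
broadcast from parents to children in the downward rounds. -/
theorem deliver_source {M : ℕ} (src : Fin M → Fin M) (s : Fin M → Multiset ℕ) (j : Fin M) :
    deliver (fun i => ∑ g ∈ Finset.univ.filter (fun g => src g = i),
      (s g).map (fun w => (g, w))) j = s j := by
  simp only [deliver, filter_map_sum, filter_map_mk]
  rw [Finset.sum_fiberwise]
  simp

/-- In one round, the memories `A` of the scenarios `ω` can be turned into the memories `B`. -/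
def MPCStep {M : ℕ} {Ω : Type} (S W : ℕ) (A B : Ω → Fin M → Multiset ℕ) : Prop :=
  ∃ msg : Fin M → Multiset ℕ → Multiset (Fin M × ℕ), ∀ ω,
    (∀ i, (msg i (A ω i)).card ≤ S) ∧
    (∀ j, B ω j = deliver (fun i => msg i (A ω i)) j) ∧
    (∀ i, (B ω i).card ≤ S) ∧ ∀ i, ∀ w ∈ B ω i, w < W

/-- In `r` rounds, the memories `A` of the scenarios `ω` can be turned into the memories `B`. -/
inductive Reach {M : ℕ} {Ω : Type} (S W : ℕ) :
    ℕ → (Ω → Fin M → Multiset ℕ) → (Ω → Fin M → Multiset ℕ) → Prop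
  | refl (A : Ω → Fin M → Multiset ℕ) : Reach S W 0 A A
  | head {r : ℕ} {A B C : Ω → Fin M → Multiset ℕ} :
      MPCStep S W A B → Reach S W r B C → Reach S W (r + 1) A C

section Reach

variable {M : ℕ} {Ω : Type} {S W : ℕ}

theorem Reach.trans {r r' : ℕ} {A B C : Ω → Fin M → Multiset ℕ} (h : Reach S W r A B)
    (h' : Reach S W r' B C) : Reach S W (r + r') A C := by
  induction h with
  | refl A => simpa using h'
  | head hs _ ih => rw [Nat.add_right_comm]; exact .head hs (ih h')

theorem MPCStep.reach {A B : Ω → Fin M → Multiset ℕ} (h : MPCStep S W A B) : Reach S W 1 A B :=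
  .head h (.refl B)

theorem Reach.iterate (A : ℕ → Ω → Fin M → Multiset ℕ) (r : ℕ)
    (h : ∀ t < r, MPCStep S W (A t) (A (t + 1))) : Reach S W r (A 0) (A r) := by
  induction r with
  | zero => exact .refl _
  | succ r ih =>
    exact (ih fun t ht => h t (by omega)).trans (h r (by omega)).reach

/-- The messages of a machine may depend on the scenario only through its memory. -/
theorem MPCStep.of_known {A B : Ω → Fin M → Multiset ℕ} (msg : Ω → Fin M → Multiset (Fin M × ℕ))
    (hk : ∀ ω ω' i, A ω i = A ω' i → msg ω i = msg ω' i)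
    (hs : ∀ ω i, (msg ω i).card ≤ S)
    (hB : ∀ ω j, B ω j = deliver (msg ω) j)
    (hc : ∀ ω i, (B ω i).card ≤ S) (hw : ∀ ω i, ∀ w ∈ B ω i, w < W) : MPCStep S W A B := by
  classical
  -- Any scenario compatible with the observed memory may be used, since `hk` makes the messages
  -- independent of this choice. The value `0` concerns memories that never occur.
  refine ⟨fun i s => if h : ∃ ω, A ω i = s then msg h.choose i else 0, fun ω => ?_⟩
  have key : ∀ i, (if h : ∃ ω', A ω' i = A ω i then msg h.choose i else 0) = msg ω i := by
    intro i
    have h : ∃ ω', A ω' i = A ω i := ⟨ω, rfl⟩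
    rw [dif_pos h]
    exact hk _ _ _ h.choose_spec
  simp only [key]
  exact ⟨hs ω, hB ω, hc ω, hw ω⟩

/-- Every machine rewrites the content of its memory. -/
theorem MPCStep.local {A B : Ω → Fin M → Multiset ℕ} (φ : Fin M → Multiset ℕ → Multiset ℕ)
    (hB : ∀ ω i, B ω i = φ i (A ω i))
    (hc : ∀ ω i, (B ω i).card ≤ S) (hw : ∀ ω i, ∀ w ∈ B ω i, w < W) : MPCStep S W A B :=
  .of_known (fun ω i => (B ω i).map (fun w => (i, w)))
    (fun ω ω' i h => by simp only [hB, h]) (fun ω i => by simpa using hc ω i)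
    (fun ω j => (deliver_self _ _).symm) hc hw

theorem MPCProgram.memory_succ' (step : ℕ → Fin M → Multiset ℕ → Multiset (Fin M × ℕ))
    (init : Fin M → Multiset ℕ) (r : ℕ) :
    (MPCProgram.mk M S step).memory init (r + 1) =
      (MPCProgram.mk M S fun r => step (r + 1)).memory
        ((MPCProgram.mk M S step).memory init 1) r := by
  induction r with
  | zero => rfl
  | succ r ih =>
    rw [MPCProgram.memory, ih]
    rfl

/-- The message rules of the successive rounds, indexed by the round number, form one program that
works for all scenarios. Memory bounds are claimed only after round `0`, because `Reach` asserts
nothing about its starting memories. -/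
theorem Reach.realize {R : ℕ} {A B : Ω → Fin M → Multiset ℕ} (h : Reach S W R A B) :
    ∃ step : ℕ → Fin M → Multiset ℕ → Multiset (Fin M × ℕ), ∀ ω,
      (MPCProgram.mk M S step).memory (A ω) R = B ω ∧
      (∀ r < R, ∀ i, (step r i ((MPCProgram.mk M S step).memory (A ω) r i)).card ≤ S) ∧
      (∀ r ≤ R, 0 < r → ∀ i, ((MPCProgram.mk M S step).memory (A ω) r i).card ≤ S ∧
        ∀ w ∈ (MPCProgram.mk M S step).memory (A ω) r i, w < W) := by
  induction h with
  | refl A =>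
    refine ⟨fun _ _ _ => 0, fun ω => ⟨rfl, by simp, fun r h1 h2 => by omega⟩⟩
  | @head r A B C hs _ ih =>
    obtain ⟨step, hstep⟩ := ih
    obtain ⟨msg, hmsg⟩ := hs
    refine ⟨fun r => Nat.casesOn r msg step, fun ω => ?_⟩
    obtain ⟨h1, h2, h3⟩ := hstep ω
    obtain ⟨m1, m2, m3, m4⟩ := hmsg ω
    have one : (MPCProgram.mk M S (fun r => Nat.casesOn r msg step)).memory (A ω) 1 = B ω := by
      funext j
      exact (m2 j).symm
    have shift : ∀ t, (MPCProgram.mk M S (fun r => Nat.casesOn r msg step)).memory (A ω) (t + 1) =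
        (MPCProgram.mk M S step).memory (B ω) t := by
      intro t
      rw [MPCProgram.memory_succ', one]
    refine ⟨by rw [shift, h1], ?_, ?_⟩
    · intro t ht i
      cases t with
      | zero => exact m1 i
      | succ t =>
        rw [shift]
        exact h2 t (by omega) i
    · intro t ht h0 i
      cases t with
      | zero => omega
      | succ t =>
        rw [shift]
        cases t with
        | zero => exact ⟨m3 i, m4 i⟩
        | succ t => exact h3 (t + 1) (by omega) (by omega) i

end Reach

/-! ### Prefix sums over a tree of machines -/

section Scan

variable {M Q : ℕ} {A : Type} [AddCommMonoid A]

/-- The parent of a machine in the tree with fan-in `F`. -/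
def treeParent (F : ℕ) (g : Fin M) : Fin M := ⟨g / F, (Nat.div_le_self _ _).trans_lt g.2⟩

/-- The sum of the values `τ` over the leaves below the node `g` of level `l`. -/
def levelSum (F : ℕ) (τ : Fin M → Fin Q → A) : ℕ → Fin M → Fin Q → A
  | 0 => τ
  | l + 1 => fun h d => ∑ g ∈ Finset.univ.filter (fun g => treeParent F g = h), levelSum F τ l g d

theorem sum_levelSum (F : ℕ) (τ : Fin M → Fin Q → A) (l : ℕ) (d : Fin Q) :
    ∑ g, levelSum F τ l g d = ∑ g, τ g d := by
  induction l with
  | zero => rfl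
  | succ l ih =>
    rw [← ih]
    exact Finset.sum_fiberwise _ _ _

/-- The same `M` machines serve as the nodes of every level, and the leaves below `g` on level `l`
have indices at least `g * F ^ l`. A node beyond the range has no leaves; when `M ≤ F ^ L`, only
node `0` matters on level `L`. -/
theorem levelSum_eq_zero {F : ℕ} (τ : Fin M → Fin Q → A) (l : ℕ) (g : Fin M)
    (d : Fin Q) (hg : M ≤ g.val * F ^ l) : levelSum F τ l g d = 0 := by
  induction l generalizing g with
  | zero =>
    have := g.2
    simp at hg
    omega
  | succ l ih =>
    refine Finset.sum_eq_zero fun g' hg' => ih g' (hg.trans ?_)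
    have : g'.val / F = g.val := congrArg Fin.val (Finset.mem_filter.1 hg').2
    rw [← this, pow_succ', ← mul_assoc]
    exact Nat.mul_le_mul_right _ (Nat.div_mul_le_self _ _)

/-- The sum of the values over the leaves below the nodes of level `l` to the left of `g`. -/
def prefixSum (F : ℕ) (τ : Fin M → Fin Q → A) (l : ℕ) (g : Fin M) (d : Fin Q) : A :=
  ∑ g' ∈ Finset.univ.filter (fun g' => g' < g), levelSum F τ l g' d

/-- Division by `F` is monotone, so the nodes to the left of `g` are all children of nodes left of
its parent, together with its own siblings to the left. The parent knows both summands, which makes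
the downward pass possible. -/
theorem prefixSum_step {F : ℕ} (τ : Fin M → Fin Q → A) (l : ℕ) (g : Fin M) (d : Fin Q) :
    prefixSum F τ l g d = prefixSum F τ (l + 1) (treeParent F g) d +
      ∑ g' ∈ Finset.univ.filter (fun g' => treeParent F g' = treeParent F g ∧ g' < g),
        levelSum F τ l g' d := by
  have hmono : ∀ a b : Fin M, treeParent F a < treeParent F b → a < b := by
    intro a b h
    by_contra hab
    exact absurd (Nat.div_le_div_right (c := F) (Fin.le_def.1 (not_lt.1 hab))) (not_le.2 h)
  have h1 : prefixSum F τ (l + 1) (treeParent F g) d =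
      ∑ g' ∈ Finset.univ.filter (fun g' => treeParent F g' < treeParent F g),
        levelSum F τ l g' d := by
    rw [prefixSum]
    simp only [levelSum]
    rw [← Finset.sum_fiberwise_of_maps_to
      (s := Finset.univ.filter (fun g' => treeParent F g' < treeParent F g))
      (t := Finset.univ.filter (fun h => h < treeParent F g)) (g := treeParent F)
      (by intro x hx; simpa using hx)]
    refine Finset.sum_congr rfl fun h hh => Finset.sum_congr ?_ fun _ _ => rfl
    ext x
    simp only [Finset.mem_filter, Finset.mem_univ, true_and] at hh ⊢
    constructor
    · rintro rfl; exact ⟨hh, rfl⟩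
    · exact fun h => h.2
  rw [h1, prefixSum, ← Finset.sum_union]
  · refine Finset.sum_congr ?_ fun _ _ => rfl
    ext x
    simp only [Finset.mem_filter, Finset.mem_univ, true_and, Finset.mem_union]
    constructor
    · intro h
      have : treeParent F x ≤ treeParent F g :=
        Nat.div_le_div_right (c := F) (Fin.le_def.1 h.le)
      rcases this.lt_or_eq with h' | h'
      · exact .inl h'
      · exact .inr ⟨h', h⟩
    · rintro (h | h)
      · exact hmono _ _ h
      · exact h.2
  · rw [Finset.disjoint_left]
    intro x hx hx'
    simp only [Finset.mem_filter, Finset.mem_univ, true_and] at hx hx'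
    exact hx.ne hx'.1

theorem treeParent_pow (F s : ℕ) (g : Fin M) :
    (treeParent F g).val / F ^ s = g.val / F ^ (s + 1) := by
  rw [treeParent, Nat.div_div_eq_div_mul, pow_succ']

/-- The word for the value `v` of the counter `d` of the node `g` of level `s`. -/
def upWord (s g d v : ℕ) : ℕ := Nat.pair 1 (Nat.pair (Nat.pair s g) (Nat.pair d v))

/-- The word for the prefix sum `v` and the total `t` of the counter `d`, on level `s`. -/
def downWord (s d v t : ℕ) : ℕ := Nat.pair 2 (Nat.pair (Nat.pair s d) (Nat.pair v t))

theorem pair_lt_sq {a b Y : ℕ} (ha : a < Y) (hb : b < Y) : Nat.pair a b < Y ^ 2 :=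
  (Nat.pair_lt_max_add_one_sq a b).trans_le (Nat.pow_le_pow_left (by simp; omega) 2)

theorem nat_le_sq (Y : ℕ) : Y ≤ Y ^ 2 := by
  rcases Y.eq_zero_or_pos with rfl | h
  · simp
  · exact Nat.le_self_pow (by norm_num) Y

theorem pair_lt_pow_eight {t a b c d Y : ℕ} (ht : t < Y) (ha : a < Y) (hb : b < Y) (hc : c < Y)
    (hd : d < Y) : Nat.pair t (Nat.pair (Nat.pair a b) (Nat.pair c d)) < Y ^ 8 := by
  have h := pair_lt_sq (pair_lt_sq ha hb) (pair_lt_sq hc hd)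
  have ht' : t < ((Y ^ 2) ^ 2) :=
    ht.trans_le ((nat_le_sq Y).trans (nat_le_sq _))
  calc _ < (((Y ^ 2) ^ 2) ^ 2) := pair_lt_sq ht' h
    _ = Y ^ 8 := by ring

variable (F : ℕ) (e : A → ℕ) (L : ℕ)

/-- The words received by the machine `h` in the upward round `s`. -/
def upWords (τ : Fin M → Fin Q → A) (s : ℕ) (h : Fin M) : Multiset ℕ :=
  ∑ g ∈ Finset.univ.filter (fun g => treeParent F g = h),
    (Finset.univ : Finset (Fin Q)).val.map (fun d : Fin Q => upWord s g d (e (levelSum F τ s g d)))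

/-- The words received by the machine `g` in the downward round `s`. -/
def downWords (τ : Fin M → Fin Q → A) (s : ℕ) (g : Fin M) : Multiset ℕ :=
  if g.val / F ^ s = 0 then
    (Finset.univ : Finset (Fin Q)).val.map
      (fun d : Fin Q => downWord s d (e (prefixSum F τ (L - s) g d)) (e (∑ i, τ i d)))
  else 0

/-- The memory of the machine `h` after `a` upward and `b` downward rounds. -/
def scanMemory (D : Fin M → Multiset ℕ) (τ : Fin M → Fin Q → A) (a b : ℕ) (h : Fin M) :
    Multiset ℕ :=
  (D h).map (Nat.pair 0) + ∑ s ∈ Finset.range a, upWords F e τ s h +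
    ∑ s ∈ Finset.range b, downWords F e L τ s h

variable {F e L}

theorem mem_upWords {τ : Fin M → Fin Q → A} {s : ℕ} {h : Fin M} {w : ℕ} :
    w ∈ upWords F e τ s h ↔
      ∃ g, treeParent F g = h ∧ ∃ d : Fin Q, upWord s g d (e (levelSum F τ s g d)) = w := by
  simp [upWords, Multiset.mem_sum]

theorem mem_downWords {τ : Fin M → Fin Q → A} {s : ℕ} {g : Fin M} {w : ℕ} :
    w ∈ downWords F e L τ s g ↔ g.val / F ^ s = 0 ∧
      ∃ d : Fin Q, downWord s d (e (prefixSum F τ (L - s) g d)) (e (∑ i, τ i d)) = w := by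
  rw [downWords]
  split_ifs with h <;> simp [h]

theorem mem_scanMemory {D : Fin M → Multiset ℕ} {τ : Fin M → Fin Q → A} {a b : ℕ} {h : Fin M}
    {w : ℕ} : w ∈ scanMemory F e L D τ a b h ↔
      (∃ x ∈ D h, Nat.pair 0 x = w) ∨
      (∃ s < a, ∃ g, treeParent F g = h ∧ ∃ d : Fin Q, upWord s g d (e (levelSum F τ s g d)) = w) ∨
      (∃ s < b, h.val / F ^ s = 0 ∧
        ∃ d : Fin Q, downWord s d (e (prefixSum F τ (L - s) h d)) (e (∑ i, τ i d)) = w) := by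
  simp only [scanMemory, Multiset.mem_add, Multiset.mem_sum, Multiset.mem_map, Finset.mem_range,
    mem_upWords, mem_downWords, or_assoc]

/-- What a machine can read off its memory during a scan. -/
theorem scanMemory_known (he : Function.Injective e) {D D' : Fin M → Multiset ℕ}
    {τ τ' : Fin M → Fin Q → A} {a b : ℕ} {h : Fin M}
    (heq : scanMemory F e L D τ a b h = scanMemory F e L D' τ' a b h) :
    D h = D' h ∧
    (∀ s < a, ∀ g, treeParent F g = h → levelSum F τ s g = levelSum F τ' s g) ∧
    (∀ s < b, h.val / F ^ s = 0 →
      prefixSum F τ (L - s) h = prefixSum F τ' (L - s) h ∧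
      ∀ d, ∑ i, τ i d = ∑ i, τ' i d) := by
  refine ⟨?_, ?_, ?_⟩
  · have key : ∀ (D : Fin M → Multiset ℕ) (τ : Fin M → Fin Q → A),
        ((scanMemory F e L D τ a b h).filter (fun w => w.unpair.1 = 0)).map
          (fun w => w.unpair.2) = D h := by
      intro D τ
      have hu : (∑ s ∈ Finset.range a, upWords F e τ s h).filter (fun w => w.unpair.1 = 0) = 0 := by
        refine Multiset.filter_eq_nil.2 fun w hw => ?_
        obtain ⟨s, -, hs⟩ := Multiset.mem_sum.1 hw
        obtain ⟨g, -, d, rfl⟩ := mem_upWords.1 hs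
        simp [upWord]
      have hd : (∑ s ∈ Finset.range b, downWords F e L τ s h).filter
          (fun w => w.unpair.1 = 0) = 0 := by
        refine Multiset.filter_eq_nil.2 fun w hw => ?_
        obtain ⟨s, -, hs⟩ := Multiset.mem_sum.1 hw
        obtain ⟨-, d, rfl⟩ := mem_downWords.1 hs
        simp [downWord]
      rw [scanMemory, Multiset.filter_add, Multiset.filter_add, hu, hd, Multiset.filter_map]
      simp
    rw [← key D τ, ← key D' τ', heq]
  · intro s hs g hg
    funext d
    have hm : upWord s g d (e (levelSum F τ s g d)) ∈ scanMemory F e L D τ a b h :=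
      mem_scanMemory.2 (.inr (.inl ⟨s, hs, g, hg, d, rfl⟩))
    rw [heq, mem_scanMemory] at hm
    rcases hm with ⟨x, -, h0⟩ | ⟨s', -, g', -, d', h1⟩ | ⟨s', -, -, d', h2⟩
    · simp [upWord] at h0
    · simp only [upWord, Nat.pair_eq_pair, true_and] at h1
      obtain ⟨⟨rfl, h3⟩, h4, h5⟩ := h1
      obtain rfl := Fin.ext h3
      obtain rfl := Fin.ext h4
      exact (he h5).symm
    · simp [upWord, downWord] at h2
  · intro s hs hh
    have key : ∀ d, prefixSum F τ (L - s) h d = prefixSum F τ' (L - s) h d ∧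
        ∑ i, τ i d = ∑ i, τ' i d := by
      intro d
      have hm : downWord s d (e (prefixSum F τ (L - s) h d)) (e (∑ i, τ i d)) ∈
          scanMemory F e L D τ a b h :=
        mem_scanMemory.2 (.inr (.inr ⟨s, hs, hh, d, rfl⟩))
      rw [heq, mem_scanMemory] at hm
      rcases hm with ⟨x, -, h0⟩ | ⟨s', -, g', -, d', h1⟩ | ⟨s', -, -, d', h2⟩
      · simp [downWord] at h0
      · simp [upWord, downWord] at h1
      · simp only [downWord, Nat.pair_eq_pair, true_and] at h2
        obtain ⟨⟨rfl, h3⟩, h4, h5⟩ := h2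
        obtain rfl := Fin.ext h3
        exact ⟨(he h4).symm, (he h5).symm⟩
    exact ⟨funext fun d => (key d).1, fun d => (key d).2⟩

theorem card_treeParent_le {F : ℕ} (hF : 0 < F) (h : Fin M) :
    (Finset.univ.filter (fun g => treeParent F g = h)).card ≤ F := by
  have : ((Finset.univ.filter (fun g => treeParent F g = h)).map Fin.valEmbedding) ⊆
      Finset.Ico (h.val * F) (h.val * F + F) := by
    intro x hx
    simp only [Finset.mem_map, Finset.mem_filter, Finset.mem_univ, true_and,
      Fin.valEmbedding_apply] at hx
    obtain ⟨g, hg, rfl⟩ := hx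
    have h1 : g.val / F = h.val := congrArg Fin.val hg
    rw [Finset.mem_Ico, ← h1]
    exact ⟨Nat.div_mul_le_self _ _, Nat.lt_div_mul_add hF⟩
  simpa using Finset.card_le_card this

theorem card_upWords_le (hF : 0 < F) (τ : Fin M → Fin Q → A) (s : ℕ) (h : Fin M) :
    (upWords F e τ s h).card ≤ F * Q := by
  simp only [upWords, Multiset.card_sum, Multiset.card_map, Finset.card_val, Finset.card_univ,
    Fintype.card_fin, Finset.sum_const, smul_eq_mul]
  exact Nat.mul_le_mul_right _ (card_treeParent_le hF h)

theorem card_downWords_le (τ : Fin M → Fin Q → A) (s : ℕ) (h : Fin M) :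
    (downWords F e L τ s h).card ≤ Q := by
  rw [downWords]
  split_ifs <;> simp

theorem card_scanMemory_le (hF : 0 < F) (D : Fin M → Multiset ℕ) (τ : Fin M → Fin Q → A)
    (a b : ℕ) (h : Fin M) :
    (scanMemory F e L D τ a b h).card ≤ (D h).card + a * (F * Q) + b * Q := by
  simp only [scanMemory, Multiset.card_add, Multiset.card_map, Multiset.card_sum]
  have h1 := Finset.sum_le_card_nsmul (Finset.range a) (fun s => (upWords F e τ s h).card) (F * Q)
    fun s _ => card_upWords_le hF τ s h
  have h2 := Finset.sum_le_card_nsmul (Finset.range b) (fun s => (downWords F e L τ s h).card) Q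
    fun s _ => card_downWords_le τ s h
  simp only [Finset.card_range, smul_eq_mul] at h1 h2
  omega

end Scan

/-! ### A scan followed by routing -/

section Superround

variable {M Q F L S Sd Y : ℕ} {Ω A : Type} [AddCommMonoid A] {e : A → ℕ}

/-- Every quantity that travels through the tree is a sum over some set of leaves. Hence a bound on
such subset sums bounds all transmitted words. -/
theorem sum_filter_levelSum (F : ℕ) (τ : Fin M → Fin Q → A) (l : ℕ) (p : Fin M → Prop)
    [DecidablePred p] (d : Fin Q) :
    ∃ s : Finset (Fin M), ∑ g ∈ Finset.univ.filter p, levelSum F τ l g d = ∑ i ∈ s, τ i d := by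
  classical
  induction l generalizing p with
  | zero => exact ⟨_, rfl⟩
  | succ l ih =>
    obtain ⟨s, hs⟩ := ih (fun g => p (treeParent F g))
    refine ⟨s, ?_⟩
    rw [← hs, ← Finset.sum_fiberwise_of_maps_to
      (s := Finset.univ.filter (fun g => p (treeParent F g)))
      (t := Finset.univ.filter p) (g := treeParent F) (by intro x hx; simpa using hx)]
    refine Finset.sum_congr rfl fun h hh => ?_
    rw [levelSum]
    refine Finset.sum_congr ?_ fun _ _ => rfl
    ext x
    simp only [Finset.mem_filter, Finset.mem_univ, true_and] at hh ⊢
    constructor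
    · rintro rfl; exact ⟨hh, rfl⟩
    · exact fun h => h.2

theorem levelSum_eq_sum (F : ℕ) (τ : Fin M → Fin Q → A) (l : ℕ) (g : Fin M) (d : Fin Q) :
    ∃ s : Finset (Fin M), levelSum F τ l g d = ∑ i ∈ s, τ i d := by
  obtain ⟨s, hs⟩ := sum_filter_levelSum F τ l (fun h => h = g) d
  exact ⟨s, by rw [← hs]; simp [Finset.filter_eq']⟩

/-- The relation between the size of the network and the space for scans: fan-in `F`, depth `L`,
`Q` counters, at most `Sd` words of data per machine, numbers below `Y`. -/
structure ScanParams (M Q F L S Sd Y : ℕ) : Prop where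
  machines_pos : 0 < M
  fan_pos : 0 < F
  machines_le_pow : M ≤ F ^ L
  depth_lt : L < Y
  machines_le : M ≤ Y
  counters_le : Q ≤ Y
  three_le : 3 ≤ Y
  space : Sd + (2 * L + 2) * (F * Q) ≤ S

/-- The first two terms are the scan words kept in memory. The extra `F * Q` leaves room for the
fresh words sent in the current round. -/
theorem scan_words_le {a b L F Q : ℕ} (hF : 0 < F) (ha : a ≤ L) (hb : b ≤ L + 1) :
    a * (F * Q) + b * Q + F * Q ≤ (2 * L + 2) * (F * Q) := by
  have h1 : Q ≤ F * Q := Nat.le_mul_of_pos_left _ hF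
  have h2 : a * (F * Q) ≤ L * (F * Q) := Nat.mul_le_mul_right _ ha
  have h3 : b * Q ≤ (L + 1) * (F * Q) := Nat.mul_le_mul hb h1
  calc a * (F * Q) + b * Q + F * Q ≤ L * (F * Q) + (L + 1) * (F * Q) + F * Q := by omega
    _ = (2 * L + 2) * (F * Q) := by ring

/-- After a scan, all machines know the sums of the values over the machines to their left and
over all machines, and route their data accordingly. -/
theorem superround (p : ScanParams M Q F L S Sd Y) (he : Function.Injective e)
    (σ : Fin M → Multiset ℕ → Fin Q → A)
    (route : Fin M → Multiset ℕ → (Fin Q → A) → (Fin Q → A) → Multiset (Fin M × ℕ))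
    {D D' : Ω → Fin M → Multiset ℕ}
    (hD : ∀ ω i, (D ω i).card ≤ Sd) (hDY : ∀ ω i, ∀ w ∈ D ω i, w < Y)
    (hσ : ∀ ω (s : Finset (Fin M)) d, e (∑ i ∈ s, σ i (D ω i) d) < Y)
    (hroute : ∀ ω i pre tot, (route i (D ω i) pre tot).card ≤ S)
    (hD' : ∀ ω j, D' ω j = deliver (fun i => route i (D ω i)
      (fun d => ∑ i' ∈ Finset.univ.filter (fun i' => i' < i), σ i' (D ω i') d)
      (fun d => ∑ i', σ i' (D ω i') d)) j)
    (hc : ∀ ω j, (D' ω j).card ≤ S) (hw : ∀ ω j, ∀ w ∈ D' ω j, w < Y) :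
    Reach S (Y ^ 8) (2 * L + 3) D D' := by
  have hF := p.fan_pos
  set τ : Ω → Fin M → Fin Q → A := fun ω i d => σ i (D ω i) d with hτ
  set mem : ℕ → ℕ → Ω → Fin M → Multiset ℕ := fun a b ω => scanMemory F e L (D ω) (τ ω) a b
    with hmem
  have hYY : Y ≤ Y ^ 8 := Nat.le_self_pow (by norm_num) Y
  have hlev : ∀ ω l g d, e (levelSum F (τ ω) l g d) < Y := by
    intro ω l g d
    obtain ⟨s, hs⟩ := levelSum_eq_sum F (τ ω) l g d
    rw [hs]
    exact hσ ω s d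
  have hpre : ∀ ω l g d, e (prefixSum F (τ ω) l g d) < Y := by
    intro ω l g d
    obtain ⟨s, hs⟩ := sum_filter_levelSum F (τ ω) l (fun g' => g' < g) d
    rw [prefixSum, hs]
    exact hσ ω s d
  have hcard : ∀ a b, a ≤ L → b ≤ L + 1 → ∀ ω i, (mem a b ω i).card + F * Q ≤ S := by
    intro a b ha hb ω i
    have h1 := card_scanMemory_le (e := e) (L := L) hF (D ω) (τ ω) a b i
    have h2 := scan_words_le (Q := Q) hF ha hb
    have h3 := p.space
    have h4 := hD ω i
    simp only [hmem]
    omega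
  have hwords : ∀ a b, a ≤ L → b ≤ L + 1 → ∀ ω i, ∀ w ∈ mem a b ω i, w < Y ^ 8 := by
    intro a b ha hb ω i w hw
    have h3 := p.three_le
    have h4 := p.depth_lt
    have h5 := p.machines_le
    have h6 := p.counters_le
    rcases mem_scanMemory.1 hw with ⟨x, hx, rfl⟩ | ⟨s, hs, g, -, d, rfl⟩ | ⟨s, hs, -, d, rfl⟩
    · exact (pair_lt_sq (by omega) (hDY ω i x hx)).trans_le
        (Nat.pow_le_pow_right (by omega) (by norm_num))
    · exact pair_lt_pow_eight (by omega) (by omega) (g.2.trans_le h5) (d.2.trans_le h6)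
        (hlev _ _ _ _)
    · exact pair_lt_pow_eight (by omega) (by omega) (d.2.trans_le h6) (hpre _ _ _ _)
        (hσ ω Finset.univ d)
  -- The data get the tag `0`, so that they can be told apart from the upward words (tag `1`) and
  -- the downward words (tag `2`).
  have start : MPCStep S (Y ^ 8) D (mem 0 0) := by
    refine .local (fun _ s => s.map (Nat.pair 0)) (fun ω i => by simp [hmem, scanMemory])
      (fun ω i => ?_) (hwords 0 0 (by omega) (by omega))
    have := hcard 0 0 (by omega) (by omega) ω i
    omega
  have up : ∀ t < L, MPCStep S (Y ^ 8) (mem t 0) (mem (t + 1) 0) := by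
    intro t ht
    refine .of_known (fun ω i => (mem t 0 ω i).map (fun w => (i, w)) +
        ((Finset.univ : Finset (Fin Q)).val.map
          (fun d : Fin Q => upWord t i d (e (levelSum F (τ ω) t i d)))).map
          (fun w => (treeParent F i, w))) ?_ ?_ ?_ ?_ (hwords _ _ (by omega) (by omega))
    · intro ω ω' i h
      have hk := scanMemory_known he h
      have : levelSum F (τ ω) t i = levelSum F (τ ω') t i := by
        cases t with
        | zero =>
          funext d
          simp only [levelSum, hτ, hk.1]
        | succ t =>
          funext d
          simp only [levelSum]
          refine Finset.sum_congr rfl fun g hg => ?_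
          rw [hk.2.1 t (by omega) g (Finset.mem_filter.1 hg).2]
      simp only [h, this]
    · intro ω i
      have h1 := hcard t 0 (by omega) (by omega) ω i
      have h2 : Q ≤ F * Q := Nat.le_mul_of_pos_left _ hF
      simp only [Multiset.card_add, Multiset.card_map, Finset.card_val, Finset.card_univ,
        Fintype.card_fin]
      omega
    · intro ω j
      rw [deliver_add, deliver_self, deliver_dest]
      simp only [hmem, scanMemory, Finset.sum_range_succ, Finset.range_zero, Finset.sum_empty,
        add_zero, add_assoc]
      rfl
    · intro ω i
      have := hcard (t + 1) 0 (by omega) (by omega) ω i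
      omega
  -- Only machine `0` acts as root: it has nothing to its left, and all other nodes of level `L`
  -- have sum zero, so its own level sum is the total.
  have top : MPCStep S (Y ^ 8) (mem L 0) (mem L 1) := by
    refine .of_known (fun ω i => (mem L 0 ω i).map (fun w => (i, w)) +
        (downWords F e L (τ ω) 0 i).map (fun w => (i, w))) ?_ ?_ ?_ ?_
        (hwords _ _ (by omega) (by omega))
    · intro ω ω' i h
      have hk := scanMemory_known he h
      have : downWords F e L (τ ω) 0 i = downWords F e L (τ ω') 0 i := by
        simp only [downWords, pow_zero, Nat.div_one]
        split_ifs with hi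
        · have hlevel : levelSum F (τ ω) L i = levelSum F (τ ω') L i := by
            rcases Nat.eq_zero_or_pos L with h0 | h0
            · subst h0
              funext d
              simp only [levelSum, hτ, hk.1]
            · obtain ⟨l, rfl⟩ : ∃ l, L = l + 1 := ⟨L - 1, by omega⟩
              funext d
              simp only [levelSum]
              refine Finset.sum_congr rfl fun g hg => ?_
              rw [hk.2.1 l (by omega) g (Finset.mem_filter.1 hg).2]
          have hzero : ∀ τ : Fin M → Fin Q → A, ∀ d, prefixSum F τ (L - 0) i d = 0 := by
            intro τ d
            refine Finset.sum_eq_zero fun g hg => ?_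
            have := Fin.lt_def.1 (Finset.mem_filter.1 hg).2
            omega
          have htot : ∀ τ : Fin M → Fin Q → A, ∀ d, ∑ i, τ i d = levelSum F τ L i d := by
            intro τ d
            rw [← sum_levelSum F τ L d]
            refine Finset.sum_eq_single i (fun g _ hg => levelSum_eq_zero τ L g d ?_) (by simp)
            have hg0 : 0 < g.val := Nat.pos_of_ne_zero fun h0 => hg (Fin.ext (h0.trans hi.symm))
            exact p.machines_le_pow.trans (Nat.le_mul_of_pos_left _ hg0)
          simp only [hzero, htot, hlevel]
        · rfl
      simp only [h, this]
    · intro ω i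
      have h1 := hcard L 0 (by omega) (by omega) ω i
      have h2 : Q ≤ F * Q := Nat.le_mul_of_pos_left _ hF
      have h3 := card_downWords_le (F := F) (e := e) (L := L) (τ ω) 0 i
      simp only [Multiset.card_add, Multiset.card_map]
      omega
    · intro ω j
      rw [deliver_add, deliver_self, deliver_self]
      simp only [hmem, scanMemory, Finset.sum_range_succ, Finset.range_zero, Finset.sum_empty,
        add_zero, zero_add]
    · intro ω i
      have := hcard L 1 (by omega) (by omega) ω i
      omega
  -- Downward round `s` serves level `L - s`, whose active nodes are those with index below `F ^ s`.
  -- The sibling sums on level `L - (t + 1)` were stored by the parent during the upward pass.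
  have down : ∀ t < L, MPCStep S (Y ^ 8) (mem L (t + 1)) (mem L (t + 1 + 1)) := by
    intro t ht
    refine .of_known (fun ω i => (mem L (t + 1) ω i).map (fun w => (i, w)) +
        ∑ g ∈ Finset.univ.filter (fun g => treeParent F g = i),
          (downWords F e L (τ ω) (t + 1) g).map (fun w => (g, w))) ?_ ?_ ?_ ?_
        (hwords _ _ (by omega) (by omega))
    · intro ω ω' i h
      have hk := scanMemory_known he h
      have : ∀ g, treeParent F g = i →
          downWords F e L (τ ω) (t + 1) g = downWords F e L (τ ω') (t + 1) g := by
        intro g hg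
        simp only [downWords]
        split_ifs with h0
        · have hp := hk.2.2 t (by omega) (by rw [← hg, treeParent_pow, h0])
          have hl : L - t = L - (t + 1) + 1 := by omega
          have hpre : ∀ d, prefixSum F (τ ω) (L - (t + 1)) g d =
              prefixSum F (τ ω') (L - (t + 1)) g d := by
            intro d
            rw [prefixSum_step (τ ω) _ g, prefixSum_step (τ ω') _ g, hg, ← hl, hp.1]
            congr 1
            refine Finset.sum_congr rfl fun g' hg' => ?_
            rw [hk.2.1 (L - (t + 1)) (by omega) g' (Finset.mem_filter.1 hg').2.1]
          simp only [hp.2, hpre]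
        · rfl
      simp only [h]
      congr 1
      refine Finset.sum_congr rfl fun g hg => ?_
      rw [this g (Finset.mem_filter.1 hg).2]
    · intro ω i
      have h1 := hcard L (t + 1) (by omega) (by omega) ω i
      have h2 := Finset.sum_le_card_nsmul (Finset.univ.filter (fun g => treeParent F g = i))
        (fun g => (downWords F e L (τ ω) (t + 1) g).card) Q fun g _ => card_downWords_le _ _ _
      have h3 := Nat.mul_le_mul_right Q (card_treeParent_le hF i)
      simp only [Multiset.card_add, Multiset.card_map, Multiset.card_sum, smul_eq_mul] at h2 ⊢
      omega
    · intro ω j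
      rw [deliver_add, deliver_self, deliver_source]
      simp only [hmem, scanMemory]
      rw [Finset.sum_range_succ _ (t + 1), add_assoc, add_assoc, add_assoc]
    · intro ω i
      have := hcard L (t + 1 + 1) (by omega) (by omega) ω i
      omega
  -- On the leaf level every machine is active because `M ≤ F ^ L`, so each knows its prefix sums
  -- and the totals.
  have finish : MPCStep S (Y ^ 8) (mem L (L + 1)) D' := by
    refine .of_known (fun ω i => route i (D ω i)
      (fun d => ∑ i' ∈ Finset.univ.filter (fun i' => i' < i), σ i' (D ω i') d)
      (fun d => ∑ i', σ i' (D ω i') d)) ?_ (fun ω i => hroute _ _ _ _) hD' hc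
      (fun ω i w h => (hw ω i w h).trans_le hYY)
    intro ω ω' i h
    have hk := scanMemory_known he h
    have h0 := hk.2.2 L (by omega) (Nat.div_eq_of_lt (i.2.trans_le p.machines_le_pow))
    have h1 : (fun d => ∑ i' ∈ Finset.univ.filter (fun i' => i' < i), σ i' (D ω i') d) =
        fun d => ∑ i' ∈ Finset.univ.filter (fun i' => i' < i), σ i' (D ω' i') d := by
      have := h0.1
      rw [Nat.sub_self] at this
      exact this
    rw [hk.1, h1, funext h0.2]
  have r1 := (start.reach.trans (Reach.iterate (fun t => mem t 0) L up)).trans top.reach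
  have r2 := (r1.trans (Reach.iterate (fun t => mem L (t + 1)) L down)).trans finish.reach
  have : 2 * L + 3 = 1 + L + 1 + L + 1 := by ring
  rw [this]
  exact r2

end Superround

/-! ### Stable counting sort -/

section Sorting

/-- In a concatenation, the position of an entry is its position in its own list plus the lengths of
the earlier lists. This lets ranks be computed locally from prefix sums. -/
theorem coe_zipIdx_flatMap_finRange {α : Type*} {n : ℕ} (l : Fin n → List α) (k : ℕ) :
    ((((List.finRange n).flatMap l).zipIdx k : List (α × ℕ)) : Multiset (α × ℕ)) =
      ∑ i, (((l i).zipIdx (k + ∑ i' ∈ Finset.univ.filter (fun i' => i' < i), (l i').length) :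
        List (α × ℕ)) : Multiset (α × ℕ)) := by
  induction n generalizing k with
  | zero => simp
  | succ n ih =>
    rw [List.finRange_succ, List.flatMap_cons, List.zipIdx_append, ← Multiset.coe_add,
      List.flatMap_map, ih, Fin.sum_univ_succ]
    congr 1
    · simp
    · refine Finset.sum_congr rfl fun i _ => ?_
      have : ∑ i' ∈ Finset.univ.filter (fun i' => i' < i.succ), (l i').length =
          (l 0).length + ∑ i' ∈ Finset.univ.filter (fun i' => i' < i), (l i'.succ).length := by
        simp [Finset.sum_filter, Fin.sum_univ_succ]
      rw [this, add_assoc]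

theorem multiset_map_sum {ι α β : Type*} (t : Finset ι) (g : ι → Multiset α) (f : α → β) :
    (∑ i ∈ t, g i).map f = ∑ i ∈ t, (g i).map f :=
  map_sum (Multiset.mapAddMonoidHom f) g t

/-- The `j`-th block of length `c` of a list. -/
def block {α : Type*} (l : List α) (c j : ℕ) : Multiset α :=
  (((l.zipIdx : List (α × ℕ)) : Multiset (α × ℕ)).filter (fun x => x.2 / c = j)).map Prod.fst

theorem mem_block {α : Type*} {l : List α} {c j : ℕ} {a : α} :
    a ∈ block l c j ↔ ∃ x, ∃ h : x < l.length, l[x] = a ∧ x / c = j := by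
  simp only [block, Multiset.mem_map, Multiset.mem_filter, Multiset.mem_coe, Prod.exists,
    List.mem_zipIdx_iff_getElem?]
  constructor
  · rintro ⟨b, x, ⟨h1, h2⟩, rfl⟩
    obtain ⟨h, rfl⟩ := List.getElem?_eq_some_iff.1 h1
    exact ⟨x, h, rfl, h2⟩
  · rintro ⟨x, h, rfl, h2⟩
    exact ⟨_, x, ⟨List.getElem?_eq_some_iff.2 ⟨h, rfl⟩, h2⟩, rfl⟩

theorem card_block_le {α : Type*} (l : List α) {c : ℕ} (hc : 0 < c) (j : ℕ) :
    (block l c j).card ≤ c := by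
  have h1 : (block l c j).card =
      ((((l.zipIdx : List (α × ℕ)) : Multiset (α × ℕ)).map Prod.snd).filter
        (fun x => x / c = j)).card := by
    rw [block, Multiset.card_map, Multiset.filter_map, Multiset.card_map]
    rfl
  have h2 : ((l.zipIdx : List (α × ℕ)) : Multiset (α × ℕ)).map Prod.snd =
      (Finset.range l.length).val := by
    simp [List.range_eq_range', Finset.range, Multiset.range]
  rw [h1, h2]
  have : ((Finset.range l.length).filter (fun x => x / c = j)) ⊆ Finset.Ico (j * c) (j * c + c) := by
    intro x hx
    have := (Finset.mem_filter.1 hx).2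
    rw [Finset.mem_Ico, ← this]
    exact ⟨Nat.div_mul_le_self _ _, Nat.lt_div_mul_add hc⟩
  have h3 := Finset.card_le_card this
  rw [Nat.card_Ico, Nat.add_sub_cancel_left] at h3
  exact h3

theorem sum_block {α : Type*} (l : List α) {c M : ℕ} (h : l.length ≤ c * M) :
    ∑ j : Fin M, block l c j = (l : Multiset α) := by
  have h1 : (l : Multiset α) = ((l.zipIdx : List (α × ℕ)) : Multiset (α × ℕ)).map Prod.fst := by
    simp
  have h2 : ∀ z : Multiset (α × ℕ), (∀ x ∈ z, x.2 / c < M) →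
      ∑ j : Fin M, (z.filter (fun x => x.2 / c = j)).map Prod.fst = z.map Prod.fst := by
    intro z
    induction z using Multiset.induction_on with
    | empty => simp
    | cons a z ih =>
      intro hz
      have ha : a.2 / c < M := hz a (Multiset.mem_cons_self _ _)
      have hj : ∀ j : Fin M, ((a ::ₘ z).filter (fun x => x.2 / c = j)).map Prod.fst =
          (if j = ⟨a.2 / c, ha⟩ then {a.1} else 0) +
            (z.filter (fun x => x.2 / c = j)).map Prod.fst := by
        intro j
        by_cases hj : a.2 / c = j.val
        · rw [Multiset.filter_cons_of_pos (p := fun x : α × ℕ => x.2 / c = j.val) _ hj,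
            if_pos (Fin.ext hj.symm)]
          simp
        · rw [Multiset.filter_cons_of_neg (p := fun x : α × ℕ => x.2 / c = j.val) _ hj,
            if_neg (fun h => hj (congrArg Fin.val h).symm)]
          simp
      simp only [hj]
      rw [Finset.sum_add_distrib, ih fun x hx => hz x (Multiset.mem_cons_of_mem hx)]
      simp
  rw [h1]
  refine h2 _ fun x hx => ?_
  have hx' : l[x.2]? = some x.1 := List.mem_zipIdx_iff_getElem?.1 hx
  have hlt := (List.getElem?_eq_some_iff.1 hx').1
  exact Nat.div_lt_of_lt_mul (hlt.trans_le h)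

/-- The items of `s` with key `d`, in the order of `f`. -/
noncomputable def bucket (key f : ℕ → ℕ) (s : Multiset ℕ) (d : ℕ) : List ℕ :=
  (s.filter (fun w => key w = d)).toList.mergeSort (fun a b => decide (f a ≤ f b))

theorem coe_bucket (key f : ℕ → ℕ) (s : Multiset ℕ) (d : ℕ) :
    (bucket key f s d : Multiset ℕ) = s.filter (fun w => key w = d) := by
  rw [bucket, Multiset.coe_eq_coe.2 (List.mergeSort_perm _ _), Multiset.coe_toList]

theorem length_bucket (key f : ℕ → ℕ) (s : Multiset ℕ) (d : ℕ) :
    (bucket key f s d).length = (s.filter (fun w => key w = d)).card := by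
  rw [← coe_bucket key f, Multiset.coe_card]

theorem mem_bucket {key f : ℕ → ℕ} {s : Multiset ℕ} {d w : ℕ} :
    w ∈ bucket key f s d ↔ w ∈ s ∧ key w = d := by
  rw [← Multiset.mem_coe, coe_bucket, Multiset.mem_filter]

theorem pairwise_bucket (key f : ℕ → ℕ) (s : Multiset ℕ) (d : ℕ) :
    (bucket key f s d).Pairwise (fun a b => f a ≤ f b) := by
  have := List.pairwise_mergeSort (le := fun a b => decide (f a ≤ f b))
    (by intro a b c; simp only [decide_eq_true_eq]; omega)
    (by intro a b; simp only [Bool.or_eq_true, decide_eq_true_eq]; omega)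
    (s.filter (fun w => key w = d)).toList
  simpa [bucket] using this

theorem sum_filter_key {Q : ℕ} (key : ℕ → ℕ) (s : Multiset ℕ) (h : ∀ w ∈ s, key w < Q) :
    ∑ d : Fin Q, s.filter (fun w => key w = d) = s := by
  induction s using Multiset.induction_on with
  | empty => simp
  | cons a s ih =>
    have ha := h a (Multiset.mem_cons_self _ _)
    have hd : ∀ d : Fin Q, (a ::ₘ s).filter (fun w => key w = d) =
        (if d = ⟨key a, ha⟩ then {a} else 0) + s.filter (fun w => key w = d) := by
      intro d
      by_cases hj : key a = d.val
      · rw [Multiset.filter_cons_of_pos (p := fun w => key w = d.val) _ hj,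
          if_pos (Fin.ext hj.symm)]
        simp
      · rw [Multiset.filter_cons_of_neg (p := fun w => key w = d.val) _ hj,
          if_neg (fun h => hj (congrArg Fin.val h).symm)]
        simp
    simp only [hd]
    rw [Finset.sum_add_distrib, ih fun x hx => h x (Multiset.mem_cons_of_mem hx)]
    simp

variable {M Q F L S Sd Y cap : ℕ} {Ω : Type}

/-- All items in the stable order by `key`. -/
noncomputable def sortedItems (Q : ℕ) (key f : ℕ → ℕ) (D : Fin M → Multiset ℕ) : List ℕ :=
  (List.finRange Q).flatMap fun d : Fin Q => (List.finRange M).flatMap fun i => bucket key f (D i) d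

theorem coe_flatMap_finRange {α : Type*} {n : ℕ} (l : Fin n → List α) :
    (((List.finRange n).flatMap l : List α) : Multiset α) = ∑ i, (l i : Multiset α) := by
  have := congrArg (Multiset.map Prod.fst) (coe_zipIdx_flatMap_finRange l 0)
  simpa [multiset_map_sum] using this

theorem coe_sortedItems {key f : ℕ → ℕ} {D : Fin M → Multiset ℕ}
    (h : ∀ i, ∀ w ∈ D i, key w < Q) : (sortedItems Q key f D : Multiset ℕ) = ∑ i, D i := by
  simp only [sortedItems, coe_flatMap_finRange, coe_bucket]
  rw [Finset.sum_comm]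
  exact Finset.sum_congr rfl fun i _ => sum_filter_key key (D i) (h i)

/-- Stability: within one key the items are listed machine by machine, which respects `f` across
machines by hypothesis and within a machine because each bucket is sorted by `f`. -/
theorem pairwise_sortedItems {key f : ℕ → ℕ} {D : Fin M → Multiset ℕ}
    (h : ∀ i j, i < j → ∀ a ∈ D i, ∀ b ∈ D j, f a ≤ f b) :
    (sortedItems Q key f D).Pairwise (fun a b => key a < key b ∨ key a = key b ∧ f a ≤ f b) := by
  rw [sortedItems, List.pairwise_flatMap]
  constructor
  · intro d _
    rw [List.pairwise_flatMap]
    constructor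
    · intro i _
      refine (pairwise_bucket key f (D i) d).imp_of_mem fun ha hb hab => .inr ⟨?_, hab⟩
      rw [(mem_bucket.1 ha).2, (mem_bucket.1 hb).2]
    · refine (List.pairwise_lt_finRange M).imp fun hij a ha b hb => .inr ⟨?_, ?_⟩
      · rw [(mem_bucket.1 ha).2, (mem_bucket.1 hb).2]
      · exact h _ _ hij a (mem_bucket.1 ha).1 b (mem_bucket.1 hb).1
  · refine (List.pairwise_lt_finRange Q).imp fun hij a ha b hb => .inl ?_
    obtain ⟨i, -, hi⟩ := List.mem_flatMap.1 ha
    obtain ⟨j, -, hj⟩ := List.mem_flatMap.1 hb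
    rw [(mem_bucket.1 hi).2, (mem_bucket.1 hj).2]
    exact hij

/-- The rank of an item splits into the total number of items with smaller keys, the number with
equal key on machines to the left, and the position in the local bucket. The first two are exactly
what a scan of the key counts provides. -/
theorem coe_zipIdx_sortedItems (Q : ℕ) (key f : ℕ → ℕ) (D : Fin M → Multiset ℕ) :
    (((sortedItems Q key f D).zipIdx : List (ℕ × ℕ)) : Multiset (ℕ × ℕ)) =
      ∑ i, ∑ d : Fin Q, (((bucket key f (D i) d).zipIdx
        ((∑ d' ∈ Finset.univ.filter (fun d' : Fin Q => d' < d),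
            ∑ i', ((D i').filter (fun w => key w = d')).card) +
          ∑ i' ∈ Finset.univ.filter (fun i' => i' < i),
            ((D i').filter (fun w => key w = d)).card) : List (ℕ × ℕ)) : Multiset (ℕ × ℕ)) := by
  rw [sortedItems, coe_zipIdx_flatMap_finRange, Finset.sum_comm]
  refine Finset.sum_congr rfl fun d _ => ?_
  rw [coe_zipIdx_flatMap_finRange]
  refine Finset.sum_congr rfl fun i _ => ?_
  have hl : ∀ d' : Fin Q, ((List.finRange M).flatMap fun i => bucket key f (D i) d').length =
      ∑ i', ((D i').filter (fun w => key w = d')).card := by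
    intro d'
    rw [← Multiset.coe_card, coe_flatMap_finRange, Multiset.card_sum]
    simp only [Multiset.coe_card, length_bucket]
  simp only [hl, length_bucket, zero_add]

/-- The machine that stores the item of rank `x`. -/
def rankMachine (cap : ℕ) (i : Fin M) (x : ℕ) : Fin M := if h : x / cap < M then ⟨x / cap, h⟩ else i

/-- The machines hold the items obtained from their data by `u`; these are redistributed in the
stable order by `key`. -/
theorem sort_pass (p : ScanParams M Q F L S Sd Y) (hcap : 0 < cap) (hcS : cap ≤ S)
    (hNY : cap * M < Y) (u : Multiset ℕ → Multiset ℕ)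
    (key f : ℕ → ℕ) (D : Ω → Fin M → Multiset ℕ) (hD : ∀ ω i, (D ω i).card ≤ Sd)
    (hDY : ∀ ω i, ∀ w ∈ D ω i, w < Y) (hu : ∀ ω i, (u (D ω i)).card ≤ S)
    (huY : ∀ ω i, ∀ w ∈ u (D ω i), w < Y)
    (hN : ∀ ω, (∑ i, u (D ω i)).card ≤ cap * M)
    (hkey : ∀ ω i, ∀ w ∈ u (D ω i), key w < Q)
    (hsorted : ∀ ω i j, i < j → ∀ a ∈ u (D ω i), ∀ b ∈ u (D ω j), f a ≤ f b) :
    ∃ D', Reach S (Y ^ 8) (2 * L + 3) D D' ∧ ∀ ω, ∑ i, D' ω i = ∑ i, u (D ω i) ∧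
      (∀ i, (D' ω i).card ≤ cap) ∧
      ∀ i j, i < j → ∀ a ∈ D' ω i, ∀ b ∈ D' ω j, key a < key b ∨ key a = key b ∧ f a ≤ f b := by
  set l : Ω → List ℕ := fun ω => sortedItems Q key f (fun i => u (D ω i)) with hl
  have hcoe : ∀ ω, (l ω : Multiset ℕ) = ∑ i, u (D ω i) := fun ω => coe_sortedItems (hkey ω)
  have hlen : ∀ ω, (l ω).length ≤ cap * M := by
    intro ω
    rw [← Multiset.coe_card, hcoe]
    exact hN ω
  refine ⟨fun ω j => block (l ω) cap j, ?_, fun ω => ⟨?_, fun i => card_block_le _ hcap _, ?_⟩⟩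
  · refine superround p (e := id) Function.injective_id
      (fun _ s d => ((u s).filter (fun w => key w = d)).card)
      -- Numbering of each bucket starts at the rank of its first item, and rank `x` goes to machine
      -- `x / cap`. The fallback of `rankMachine` is never used, because all ranks are below `cap *
      -- M`.
      (fun i s pre tot => ∑ d : Fin Q, (((bucket key f (u s) d).zipIdx
        ((∑ d' ∈ Finset.univ.filter (fun d' : Fin Q => d' < d), tot d') + pre d) :
          List (ℕ × ℕ)) : Multiset (ℕ × ℕ)).map (fun x => (rankMachine cap i x.2, x.1)))
      hD hDY ?_ ?_ ?_ ?_ ?_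
    · intro ω s d
      refine lt_of_le_of_lt ?_ hNY
      refine le_trans ?_ (hN ω)
      rw [Multiset.card_sum, id]
      calc _ ≤ ∑ i, ((u (D ω i)).filter (fun w => key w = d)).card :=
            Finset.sum_le_sum_of_subset (Finset.subset_univ _)
        _ ≤ _ := Finset.sum_le_sum fun i _ => Multiset.card_le_card (Multiset.filter_le _ _)
    · intro ω i pre tot
      simp only [Multiset.card_sum, Multiset.card_map, Multiset.coe_card, List.length_zipIdx,
        length_bucket]
      rw [← Multiset.card_sum, sum_filter_key key _ (hkey ω i)]
      exact hu ω i
    · intro ω j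
      have hdest : ∀ i : Fin M, ∀ z : Multiset (ℕ × ℕ), (∀ x ∈ z, x.2 / cap < M) →
          ((z.map (fun x => (rankMachine cap i x.2, x.1))).filter (fun x => x.1 = j)).map Prod.snd =
            (z.filter (fun x => x.2 / cap = j)).map Prod.fst := by
        intro i z hz
        rw [Multiset.filter_map, Multiset.map_map]
        have : z.filter ((fun x : Fin M × ℕ => x.1 = j) ∘ fun x : ℕ × ℕ =>
            (rankMachine cap i x.2, x.1)) = z.filter (fun x => x.2 / cap = j) := by
          refine Multiset.filter_congr fun x hx => ?_
          simp [rankMachine, hz x hx, Fin.ext_iff]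
        rw [this]
        rfl
      have hz := coe_zipIdx_sortedItems Q key f (fun i => u (D ω i))
      have hlt : ∀ x ∈ (((l ω).zipIdx : List (ℕ × ℕ)) : Multiset (ℕ × ℕ)), x.2 / cap < M := by
        intro x hx
        have hx' : (l ω)[x.2]? = some x.1 := List.mem_zipIdx_iff_getElem?.1 hx
        exact Nat.div_lt_of_lt_mul ((List.getElem?_eq_some_iff.1 hx').1.trans_le (hlen ω))
      simp only [hl] at hlt
      rw [hz] at hlt
      have hsf : ∀ {ι : Type} (t : Finset ι) (g : ι → Multiset (ℕ × ℕ)),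
          ((∑ i ∈ t, g i).filter (fun x => x.2 / cap = j)).map Prod.fst =
            ∑ i ∈ t, ((g i).filter (fun x => x.2 / cap = j)).map Prod.fst := by
        intro ι t g
        classical
        induction t using Finset.induction_on with
        | empty => simp
        | insert a t ha ih => simp [Finset.sum_insert ha, Multiset.filter_add, ih]
      simp only [block, hl, hz, hsf, deliver, filter_map_sum]
      refine Finset.sum_congr rfl fun i _ => Finset.sum_congr rfl fun d _ => ?_
      rw [hdest i _ fun x hx => hlt x ?_]
      exact Multiset.mem_sum.2 ⟨i, Finset.mem_univ _, Multiset.mem_sum.2 ⟨d, Finset.mem_univ _, hx⟩⟩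
    · exact fun ω j => (card_block_le _ hcap _).trans hcS
    · intro ω j w hw
      obtain ⟨x, hx, rfl, -⟩ := mem_block.1 hw
      have : (l ω)[x] ∈ (l ω : Multiset ℕ) := Multiset.mem_coe.2 (List.getElem_mem hx)
      rw [hcoe] at this
      obtain ⟨i, -, hi⟩ := Multiset.mem_sum.1 this
      exact huY ω i _ hi
  · rw [sum_block _ (hlen ω), hcoe]
  · intro i j hij a ha b hb
    obtain ⟨x, hx, rfl, hxi⟩ := mem_block.1 ha
    obtain ⟨y, hy, rfl, hyj⟩ := mem_block.1 hb
    have hxy : x < y := by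
      by_contra h
      have := Nat.div_le_div_right (c := cap) (not_lt.1 h)
      have := Fin.lt_def.1 hij
      omega
    exact List.pairwise_iff_getElem.1 (pairwise_sortedItems (hsorted ω)) x y hx hy hxy

end Sorting

/-! ### Constant-round operations on distributed collections -/

/-- The parameters of a network whose machines store up to `cap` items each. -/
structure NetParams (M Q F L S Sd Y cap : ℕ) : Prop extends ScanParams M Q F L S Sd Y where
  cap_pos : 0 < cap
  three_cap_le : 3 * cap ≤ Sd
  cap_mul_lt : cap * M < Y
  counters_pos : 0 < Q

/-- The items `X` are stored in the machines, at most `cap` in each. -/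
structure Stored {M : ℕ} {Ω : Type} (cap : ℕ) (X : Ω → Multiset ℕ)
    (D : Ω → Fin M → Multiset ℕ) : Prop where
  sum_eq : ∀ ω, ∑ i, D ω i = X ω
  card_le : ∀ ω i, (D ω i).card ≤ cap

section Stored

variable {M Q F L S Sd Y cap : ℕ} {Ω : Type} {X : Ω → Multiset ℕ} {D : Ω → Fin M → Multiset ℕ}

theorem NetParams.cap_le (p : NetParams M Q F L S Sd Y cap) : cap ≤ Sd := by
  have := p.three_cap_le
  omega

theorem NetParams.data_le_space (p : NetParams M Q F L S Sd Y cap) : Sd ≤ S :=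
  le_trans (Nat.le_add_right _ _) p.space

theorem Stored.mem (h : Stored cap X D) {ω : Ω} {i : Fin M} {w : ℕ} (hw : w ∈ D ω i) : w ∈ X ω := by
  rw [← h.sum_eq ω]
  exact Multiset.mem_sum.2 ⟨i, Finset.mem_univ _, hw⟩

theorem Stored.exists_mem (h : Stored cap X D) {ω : Ω} {w : ℕ} (hw : w ∈ X ω) :
    ∃ i, w ∈ D ω i := by
  rw [← h.sum_eq ω] at hw
  obtain ⟨i, -, hi⟩ := Multiset.mem_sum.1 hw
  exact ⟨i, hi⟩

theorem Stored.card_total_le (h : Stored cap X D) (ω : Ω) : (X ω).card ≤ cap * M := by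
  rw [← h.sum_eq, Multiset.card_sum]
  refine (Finset.sum_le_card_nsmul _ _ cap fun i _ => h.card_le ω i).trans ?_
  simp [mul_comm]

/-- Sorting in a constant number of passes. -/
theorem Stored.sort (p : NetParams M Q F L S Sd Y cap) (h : Stored cap X D)
    (hY : ∀ ω, ∀ w ∈ X ω, w < Y) (K : ℕ → ℕ) (P : ℕ) (hK : ∀ ω, ∀ w ∈ X ω, K w < Q ^ P) :
    ∃ D', Reach S (Y ^ 8) (P * (2 * L + 3)) D D' ∧ Stored cap X D' ∧
      ∀ ω i j, i < j → ∀ a ∈ D' ω i, ∀ b ∈ D' ω j, K a ≤ K b := by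
  -- Radix sort in base `Q`, least significant digit first: after `t` stable passes the machines are
  -- ordered by the last `t` digits of `K`. Order is asserted only between different machines, since
  -- a memory is a multiset.
  have main : ∀ t, ∃ D', Reach S (Y ^ 8) (t * (2 * L + 3)) D D' ∧ Stored cap X D' ∧
      ∀ ω i j, i < j → ∀ a ∈ D' ω i, ∀ b ∈ D' ω j, K a % Q ^ t ≤ K b % Q ^ t := by
    intro t
    induction t with
    | zero => exact ⟨D, by simpa using Reach.refl D, h, by simp [Nat.mod_one]⟩
    | succ t ih =>
      obtain ⟨D₁, hr, hs, hm⟩ := ih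
      obtain ⟨D₂, hr₂, hD₂⟩ := sort_pass p.toScanParams p.cap_pos (p.cap_le.trans p.data_le_space)
        p.cap_mul_lt id (fun w => K w / Q ^ t % Q) (fun w => K w % Q ^ t) D₁
        (fun ω i => (hs.card_le ω i).trans p.cap_le) (fun ω i w hw => hY ω w (hs.mem hw))
        (fun ω i => (hs.card_le ω i).trans (p.cap_le.trans p.data_le_space))
        (fun ω i w hw => hY ω w (hs.mem hw))
        (fun ω => by simpa only [id, hs.sum_eq] using h.card_total_le ω)
        (fun ω i w _ => Nat.mod_lt _ p.counters_pos) hm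
      refine ⟨D₂, by rw [add_one_mul]; exact hr.trans hr₂,
        ⟨fun ω => (hD₂ ω).1.trans (hs.sum_eq ω), fun ω => (hD₂ ω).2.1⟩, ?_⟩
      intro ω i j hij a ha b hb
      rw [pow_succ, Nat.mod_mul, Nat.mod_mul]
      have hlt : K a % Q ^ t < Q ^ t := Nat.mod_lt _ (pow_pos p.counters_pos t)
      rcases (hD₂ ω).2.2 i j hij a ha b hb with h1 | ⟨h1, h2⟩
      · have : Q ^ t * (K a / Q ^ t % Q + 1) ≤ Q ^ t * (K b / Q ^ t % Q) :=
          Nat.mul_le_mul_left _ h1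
        rw [mul_add_one] at this
        have h0 := Nat.zero_le (K b % Q ^ t)
        generalize K b % Q ^ t = x at *
        omega
      · rw [h1]
        omega
  obtain ⟨D', hr, hs, hm⟩ := main P
  refine ⟨D', hr, hs, fun ω i j hij a ha b hb => ?_⟩
  have := hm ω i j hij a ha b hb
  rwa [Nat.mod_eq_of_lt (hK ω a (hs.mem ha)), Nat.mod_eq_of_lt (hK ω b (hs.mem hb))] at this

theorem sum_bind {ι : Type*} (t : Finset ι) (g : ι → Multiset ℕ) (φ : ℕ → Multiset ℕ) :
    ∑ i ∈ t, (g i).bind φ = (∑ i ∈ t, g i).bind φ := by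
  classical
  induction t using Finset.induction_on with
  | empty => simp
  | insert a t ha ih => simp [Finset.sum_insert ha, Multiset.add_bind, ih]

/-- Every item is replaced by at most three items. -/
theorem Stored.expand (p : NetParams M Q F L S Sd Y cap) (h : Stored cap X D)
    (hY : ∀ ω, ∀ w ∈ X ω, w < Y) (φ : ℕ → Multiset ℕ) (hφ : ∀ w, (φ w).card ≤ 3)
    (hφY : ∀ ω, ∀ w ∈ X ω, ∀ x ∈ φ w, x < Y)
    (hN : ∀ ω, ((X ω).bind φ).card ≤ cap * M) :
    ∃ D', Reach S (Y ^ 8) (2 * L + 3) D D' ∧ Stored cap (fun ω => (X ω).bind φ) D' := by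
  obtain ⟨D', hr, hD'⟩ := sort_pass p.toScanParams p.cap_pos (p.cap_le.trans p.data_le_space)
    p.cap_mul_lt (fun s => s.bind φ) (fun _ => 0) (fun _ => 0) D
    (fun ω i => (h.card_le ω i).trans p.cap_le) (fun ω i w hw => hY ω w (h.mem hw))
    (fun ω i => by
      rw [Multiset.card_bind]
      have h1 := Multiset.sum_le_card_nsmul ((D ω i).map (Multiset.card ∘ φ)) 3
        (by simpa using fun w _ => hφ w)
      have h2 := h.card_le ω i
      have h3 := p.three_cap_le
      have h4 := p.data_le_space
      simp only [Multiset.card_map, smul_eq_mul] at h1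
      omega)
    (fun ω i x hx => by
      obtain ⟨w, hw, hxw⟩ := Multiset.mem_bind.1 hx
      exact hφY ω w (h.mem hw) x hxw)
    (fun ω => by rw [sum_bind, h.sum_eq]; exact hN ω)
    (fun ω i w _ => p.counters_pos) (fun _ _ _ _ _ _ _ _ => le_rfl)
  exact ⟨D', hr, fun ω => by rw [(hD' ω).1, sum_bind, h.sum_eq], fun ω => (hD' ω).2.1⟩

/-- The natural numbers with the maximum as addition. -/
structure MaxNat where
  val : ℕ

@[ext] theorem MaxNat.ext {a b : MaxNat} (h : a.val = b.val) : a = b := by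
  cases a; cases b; simp_all

instance : Add MaxNat := ⟨fun a b => ⟨max a.val b.val⟩⟩

instance : Zero MaxNat := ⟨⟨0⟩⟩

instance : AddCommMonoid MaxNat where
  nsmul := nsmulRec
  add_assoc a b c := MaxNat.ext (max_assoc _ _ _)
  zero_add a := MaxNat.ext (Nat.zero_max _)
  add_zero a := MaxNat.ext (Nat.max_zero _)
  add_comm a b := MaxNat.ext (max_comm _ _)

theorem MaxNat.val_sum {ι : Type*} (s : Finset ι) (f : ι → MaxNat) :
    (∑ i ∈ s, f i).val = s.sup (fun i => (f i).val) := by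
  classical
  induction s using Finset.induction_on with
  | empty => rfl
  | insert a s ha ih =>
    rw [Finset.sum_insert ha, Finset.sup_insert, ← ih]
    rfl

theorem MaxNat.val_injective : Function.Injective MaxNat.val := fun _ _ h => MaxNat.ext h

/-- The machines rewrite their data, knowing the maximum of `μ` over the machines to their left. -/
theorem max_superround (p : NetParams M Q F L S Sd Y cap) (h : Stored cap X D)
    (hY : ∀ ω, ∀ w ∈ X ω, w < Y) (μ : ℕ → ℕ) (hμ : ∀ ω, ∀ w ∈ X ω, μ w < Y)
    (G : ℕ → Multiset ℕ → Multiset ℕ) (hG : ∀ x s, (G x s).card ≤ s.card)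
    {D' : Ω → Fin M → Multiset ℕ}
    (hD' : ∀ ω i, D' ω i = G ((Finset.univ.filter (fun j => j < i)).sup
      (fun j => ((D ω j).map μ).sup)) (D ω i))
    (hD'Y : ∀ ω i, ∀ w ∈ D' ω i, w < Y) :
    Reach S (Y ^ 8) (2 * L + 3) D D' := by
  have hY0 : 0 < Y := by have := p.three_le; omega
  have hcS : cap ≤ S := p.cap_le.trans p.data_le_space
  refine superround p.toScanParams (e := MaxNat.val) MaxNat.val_injective
    (fun _ s _ => ⟨(s.map μ).sup⟩)
    (fun i s pre _ => (G (pre ⟨0, p.counters_pos⟩).val s).map (fun w => (i, w)))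
    (fun ω i => (h.card_le ω i).trans p.cap_le) (fun ω i w hw => hY ω w (h.mem hw)) ?_ ?_ ?_ ?_
    hD'Y
  · intro ω s d
    rw [MaxNat.val_sum, Finset.sup_lt_iff hY0]
    intro i _
    have : ((D ω i).map μ).sup ≤ Y - 1 := by
      refine Multiset.sup_le.2 fun b hb => ?_
      obtain ⟨w, hw, rfl⟩ := Multiset.mem_map.1 hb
      have := hμ ω w (h.mem hw)
      omega
    show ((D ω i).map μ).sup < Y
    omega
  · intro ω i pre tot
    rw [Multiset.card_map]
    exact (hG _ _).trans ((h.card_le ω i).trans hcS)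
  · intro ω j
    rw [deliver_self, hD', MaxNat.val_sum]
  · intro ω j
    rw [hD']
    exact (hG _ _).trans ((h.card_le ω j).trans hcS)

/-- The least second component of the items in `X` with first component `u`. -/
noncomputable def groupMin (fs sn : ℕ → ℕ) (X : Multiset ℕ) (u : ℕ) : ℕ :=
  sInf {v | ∃ w ∈ X, fs w = u ∧ sn w = v}

/-- Every item learns the minimum of its group. -/
theorem Stored.annotate (p : NetParams M Q F L S Sd Y cap) (h : Stored cap X D)
    (hY : ∀ ω, ∀ w ∈ X ω, w < Y) (fs sn : ℕ → ℕ) (Z P : ℕ)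
    (hfs : ∀ ω, ∀ w ∈ X ω, fs w < Z) (hsn : ∀ ω, ∀ w ∈ X ω, sn w < Z)
    (hP : Z ^ 2 ≤ Q ^ P) (hZ : Z ^ 2 ≤ Y) (g : ℕ → ℕ → ℕ)
    (hgY : ∀ ω, ∀ w ∈ X ω, g w (groupMin fs sn (X ω) (fs w)) < Y) :
    ∃ D', Reach S (Y ^ 8) (P * (2 * L + 3) + (2 * L + 3)) D D' ∧
      Stored cap (fun ω => (X ω).map fun w => g w (groupMin fs sn (X ω) (fs w))) D' := by
  have hlt : ∀ a b, a < Z → b < Z → a * Z + b < Z ^ 2 := by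
    intro a b ha hb
    have := Nat.mul_le_mul_right Z ha
    rw [Nat.succ_mul] at this
    rw [sq]
    omega
  obtain ⟨D₁, hr, hs, hsort⟩ := h.sort p hY (fun w => fs w * Z + sn w) P
    (fun ω w hw => (hlt _ _ (hfs ω w hw) (hsn ω w hw)).trans_le hP)
  -- Reversing the second component makes a maximum do the work of a minimum: among the items of
  -- groups up to that of `w`, the maximum of `μ` is attained in the group of `w` at its least `sn`,
  -- which is then read off modulo `Z`.
  set μ : ℕ → ℕ := fun w => fs w * Z + (Z - 1 - sn w) with hμ
  set G : ℕ → Multiset ℕ → Multiset ℕ := fun x s => s.map fun w =>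
    g w (Z - 1 - (max x ((s.filter (fun y => fs y ≤ fs w)).map μ).sup) % Z) with hG
  have key : ∀ ω i, G ((Finset.univ.filter (fun j => j < i)).sup
      (fun j => ((D₁ ω j).map μ).sup)) (D₁ ω i) =
      (D₁ ω i).map fun w => g w (groupMin fs sn (X ω) (fs w)) := by
    intro ω i
    refine Multiset.map_congr rfl fun w hw => ?_
    congr 1
    have hwX := hs.mem hw
    obtain ⟨y, hyX, hyf, hym⟩ : groupMin fs sn (X ω) (fs w) ∈
        {v | ∃ y ∈ X ω, fs y = fs w ∧ sn y = v} := Nat.sInf_mem ⟨_, w, hwX, rfl, rfl⟩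
    have hmin : ∀ z ∈ X ω, fs z = fs w → groupMin fs sn (X ω) (fs w) ≤ sn z :=
      fun z hz hzf => Nat.sInf_le ⟨z, hz, hzf, rfl⟩
    have hyZ := hsn ω y hyX
    have hbound : ∀ z ∈ X ω, fs z ≤ fs w → μ z ≤ μ y := by
      intro z hz hzf
      have h1 := hsn ω z hz
      rcases hzf.lt_or_eq with h2 | h2
      · have := Nat.mul_le_mul_right Z h2
        rw [Nat.succ_mul] at this
        simp only [hμ, hyf]
        omega
      · have := hmin z hz h2
        simp only [hμ, hyf, h2]
        omega
    have hmax : max ((Finset.univ.filter (fun j => j < i)).sup (fun j => ((D₁ ω j).map μ).sup))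
        (((D₁ ω i).filter (fun y => fs y ≤ fs w)).map μ).sup = μ y := by
      refine le_antisymm (max_le (Finset.sup_le fun j hj => Multiset.sup_le.2 fun b hb => ?_)
        (Multiset.sup_le.2 fun b hb => ?_)) ?_
      · obtain ⟨z, hz, rfl⟩ := Multiset.mem_map.1 hb
        refine hbound z (hs.mem hz) ?_
        have h1 := hsort ω j i (Finset.mem_filter.1 hj).2 z hz w hw
        by_contra h2
        have h3 := Nat.mul_le_mul_right Z (not_le.1 h2)
        rw [Nat.succ_mul] at h3
        have h4 := hsn ω w hwX
        omega
      · obtain ⟨z, hz, rfl⟩ := Multiset.mem_map.1 hb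
        exact hbound z (hs.mem (Multiset.mem_filter.1 hz).1) (Multiset.mem_filter.1 hz).2
      · obtain ⟨j, hj⟩ := hs.exists_mem hyX
        rcases lt_trichotomy j i with hji | rfl | hij
        · refine le_max_of_le_left (le_trans ?_ (Finset.le_sup (f := fun j => ((D₁ ω j).map μ).sup)
            (Finset.mem_filter.2 ⟨Finset.mem_univ _, hji⟩)))
          exact Multiset.le_sup (Multiset.mem_map_of_mem _ hj)
        · refine le_max_of_le_right (Multiset.le_sup (Multiset.mem_map_of_mem _ ?_))
          exact Multiset.mem_filter.2 ⟨hj, hyf.le⟩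
        -- If a minimal item sits to the right of `w`, then sortedness forces `w` to be minimal too,
        -- so the local part of the maximum already suffices.
        · have h1 := hsort ω i j hij w hw y hj
          have h2 := hmin w hwX rfl
          have h3 : μ y = μ w := by
            simp only [hyf] at h1
            simp only [hμ, hyf]
            omega
          rw [h3]
          refine le_max_of_le_right (Multiset.le_sup (Multiset.mem_map_of_mem _ ?_))
          exact Multiset.mem_filter.2 ⟨hw, le_rfl⟩
    rw [hmax, ← hym]
    simp only [hμ]
    rw [Nat.mul_add_mod', Nat.mod_eq_of_lt (by omega)]
    omega
  refine ⟨fun ω i => (D₁ ω i).map fun w => g w (groupMin fs sn (X ω) (fs w)),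
    hr.trans (max_superround p hs hY μ ?_ G (fun x s => by simp [hG]) (fun ω i => (key ω i).symm)
      ?_), fun ω => ?_, fun ω i => by simpa using hs.card_le ω i⟩
  · intro ω w hw
    have := hsn ω w hw
    exact (hlt _ _ (hfs ω w hw) (by omega)).trans_le hZ
  · intro ω i x hx
    obtain ⟨w, hw, rfl⟩ := Multiset.mem_map.1 hx
    exact hgY ω w (hs.mem hw)
  · rw [← multiset_map_sum, hs.sum_eq]

/-- Repeated items are discarded. -/
theorem Stored.dedup (p : NetParams M Q F L S Sd Y cap) (h : Stored cap X D)
    (hY : ∀ ω, ∀ w ∈ X ω, w + 1 < Y) (P : ℕ) (hP : ∀ ω, ∀ w ∈ X ω, w < Q ^ P) :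
    ∃ D', Reach S (Y ^ 8) (P * (2 * L + 3) + (2 * L + 3)) D D' ∧
      Stored cap (fun ω => (X ω).dedup) D' := by
  have hY' : ∀ ω, ∀ w ∈ X ω, w < Y := fun ω w hw => (Nat.lt_succ_self w).trans (hY ω w hw)
  obtain ⟨D₁, hr, hs, hsort⟩ := h.sort p hY' id P hP
  -- After sorting, a copy of `w` survives only on the first machine that holds `w`. The shift by
  -- one distinguishes an empty left side, with maximum `0`, from a left side containing the word
  -- `0`.
  set G : ℕ → Multiset ℕ → Multiset ℕ := fun x s => s.dedup.filter fun w => x < w + 1 with hG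
  have hGc : ∀ x s, (G x s).card ≤ s.card := fun x s =>
    Multiset.card_le_card ((Multiset.filter_le _ _).trans (Multiset.dedup_le _))
  set D₂ : Ω → Fin M → Multiset ℕ := fun ω i => G ((Finset.univ.filter (fun j => j < i)).sup
      (fun j => ((D₁ ω j).map (· + 1)).sup)) (D₁ ω i) with hD₂
  have hmem : ∀ ω i w, w ∈ D₂ ω i ↔ w ∈ D₁ ω i ∧ ∀ j < i, w ∉ D₁ ω j := by
    intro ω i w
    simp only [hD₂, hG, Multiset.mem_filter, Multiset.mem_dedup]
    refine and_congr_right fun hw => ?_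
    rw [Finset.sup_lt_iff (Nat.succ_pos w)]
    constructor
    · intro h1 j hj hwj
      have h2 := h1 j (Finset.mem_filter.2 ⟨Finset.mem_univ _, hj⟩)
      exact absurd (Multiset.le_sup (Multiset.mem_map_of_mem (· + 1) hwj)) (not_le.2 h2)
    · intro h1 j hj
      have hj := (Finset.mem_filter.1 hj).2
      refine Nat.lt_succ_of_le (Multiset.sup_le.2 fun b hb => ?_)
      obtain ⟨y, hy, rfl⟩ := Multiset.mem_map.1 hb
      have h2 : y ≤ w := hsort ω j i hj y hy w hw
      exact lt_of_le_of_ne h2 fun h3 => h1 j hj (h3 ▸ hy)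
  refine ⟨D₂, hr.trans (max_superround p hs hY' (· + 1) hY G hGc (fun ω i => rfl) ?_),
    fun ω => ?_, fun ω i => (hGc _ _).trans (hs.card_le ω i)⟩
  · intro ω i w hw
    exact hY' ω w (hs.mem ((hmem ω i w).1 hw).1)
  · refine (Multiset.Nodup.ext ?_ (Multiset.nodup_dedup _)).2 fun w => ?_
    · rw [Multiset.nodup_iff_count_le_one]
      intro w
      rw [Multiset.count_sum']
      have hnd : ∀ i, (D₂ ω i).count w ≤ 1 := fun i =>
        Multiset.nodup_iff_count_le_one.1 ((Multiset.nodup_dedup _).filter _) w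
      by_cases hex : ∃ i, w ∈ D₂ ω i
      · obtain ⟨i, hi⟩ := hex
        rw [Finset.sum_eq_single i]
        · exact hnd i
        · intro j _ hji
          rw [Multiset.count_eq_zero]
          intro hj
          rw [hmem] at hi hj
          rcases lt_or_gt_of_ne hji with h1 | h1
          · exact hi.2 j h1 hj.1
          · exact hj.2 i h1 hi.1
        · simp
      · rw [Finset.sum_eq_zero]
        · exact Nat.zero_le _
        · intro i _
          exact Multiset.count_eq_zero.2 fun hi => hex ⟨i, hi⟩
    · rw [Multiset.mem_dedup, Multiset.mem_sum]
      constructor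
      · rintro ⟨i, -, hi⟩
        exact hs.mem ((hmem ω i w).1 hi).1
      · intro hw
        obtain ⟨i, hi⟩ := hs.exists_mem hw
        obtain ⟨j, hj, hjm⟩ := WellFounded.has_min (r := ((· < ·) : Fin M → Fin M → Prop))
          wellFounded_lt {i | w ∈ D₁ ω i} ⟨i, hi⟩
        exact ⟨j, Finset.mem_univ _, (hmem ω j w).2 ⟨hj, fun k hk hwk => hjm k hwk hk⟩⟩

/-- All items learn a choice that depends on the totals of the counters. -/
theorem Stored.select (p : NetParams M Q F L S Sd Y cap) (h : Stored cap X D)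
    (hY : ∀ ω, ∀ w ∈ X ω, w < Y) (cnt : ℕ → Fin Q → ℕ) (hcnt : ∀ w d, cnt w d ≤ 1)
    (sel : (Fin Q → ℕ) → ℕ)
    (hsel : ∀ ω t, ∀ w ∈ X ω, Nat.pair w (sel t) < Y) :
    ∃ D', Reach S (Y ^ 8) (2 * L + 3) D D' ∧ Stored cap (fun ω => (X ω).map fun w =>
      Nat.pair w (sel fun d => ((X ω).map fun w => cnt w d).sum)) D' := by
  have hcS : cap ≤ S := p.cap_le.trans p.data_le_space
  have hsum : ∀ ω (t : Finset (Fin M)) d, ∑ i ∈ t, ((D ω i).map fun w => cnt w d).sum =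
      ((∑ i ∈ t, D ω i).map fun w => cnt w d).sum := by
    intro ω t d
    rw [multiset_map_sum]
    exact (map_sum Multiset.sumAddMonoidHom _ _).symm
  refine ⟨fun ω i => (D ω i).map fun w =>
      Nat.pair w (sel fun d => ((X ω).map fun w => cnt w d).sum),
    superround p.toScanParams (e := id) Function.injective_id
    (fun _ s d => (s.map fun w => cnt w d).sum)
    (fun i s _ tot => (s.map fun w => Nat.pair w (sel tot)).map (fun w => (i, w)))
    (fun ω i => (h.card_le ω i).trans p.cap_le) (fun ω i w hw => hY ω w (h.mem hw)) ?_ ?_ ?_ ?_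
    ?_, fun ω => ?_, fun ω i => ?_⟩
  · intro ω t d
    refine lt_of_le_of_lt ?_ p.cap_mul_lt
    refine le_trans ?_ (h.card_total_le ω)
    rw [id, hsum]
    have h1 : ∀ x ∈ (∑ i ∈ t, D ω i).map (fun w => cnt w d), x ≤ 1 := by
      intro x hx
      obtain ⟨w, -, rfl⟩ := Multiset.mem_map.1 hx
      exact hcnt w d
    refine (Multiset.sum_le_card_nsmul _ 1 h1).trans ?_
    rw [Multiset.card_map, smul_eq_mul, mul_one, ← h.sum_eq]
    exact Multiset.card_le_card (Finset.sum_le_sum_of_subset (Finset.subset_univ _))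
  · intro ω i pre tot
    simpa using (h.card_le ω i).trans hcS
  · intro ω j
    rw [deliver_self]
    simp only [hsum, h.sum_eq]
  · intro ω j
    simpa using (h.card_le ω j).trans hcS
  · intro ω j x hx
    obtain ⟨w, hw, rfl⟩ := Multiset.mem_map.1 hx
    exact hsel _ _ _ (h.mem hw)
  · rw [← multiset_map_sum, h.sum_eq]
  · simpa using h.card_le ω i

/-- Two words are packed into one. -/
def packList : List ℕ → Multiset ℕ
  | [] => 0
  | [a] => {Nat.pair a 0}
  | a :: b :: l => Nat.pair a (b + 1) ::ₘ packList l

/-- The inverse of packing. -/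
def unpack (s : Multiset ℕ) : Multiset ℕ :=
  s.bind fun w => if w.unpair.2 = 0 then {w.unpair.1} else {w.unpair.1, w.unpair.2 - 1}

theorem unpack_packList (l : List ℕ) : unpack (packList l) = l := by
  induction l using packList.induct with
  | case1 => rfl
  | case2 a => simp [unpack, packList]
  | case3 a b l ih =>
    rw [packList, unpack, Multiset.cons_bind, ← unpack, ih]
    simp

/-- Packing halves a memory that is full at the start, which frees the space that a scan needs. In a
packed word, second component `0` means that only one word is present. -/
theorem card_packList_le (l : List ℕ) : (packList l).card ≤ l.length / 2 + 1 := by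
  induction l using packList.induct with
  | case1 => simp [packList]
  | case2 a => simp [packList]
  | case3 a b l ih =>
    simp only [packList, Multiset.card_cons, List.length_cons]
    omega

theorem lt_of_mem_packList {B : ℕ} (l : List ℕ) (hl : ∀ w ∈ l, w + 1 < B) :
    ∀ w ∈ packList l, w < B ^ 2 := by
  induction l using packList.induct with
  | case1 => simp [packList]
  | case2 a =>
    intro w hw
    have ha := hl a (by simp)
    rw [packList, Multiset.mem_singleton] at hw
    subst hw
    exact pair_lt_sq (by omega) (by omega)
  | case3 a b l ih =>
    intro w hw
    have ha := hl a (by simp)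
    have hb := hl b (by simp)
    rcases Multiset.mem_cons.1 hw with rfl | hw
    · exact pair_lt_sq (by omega) hb
    · exact ih (fun w hw => hl w (by simp [hw])) w hw

/-- Any initial distribution can be balanced. -/
theorem balance (p : NetParams M Q F L S Sd Y cap) (init : Ω → Fin M → Multiset ℕ)
    (hS : S / 2 + 1 ≤ Sd) (hcard : ∀ ω i, (init ω i).card ≤ S) {B : ℕ} (hBY : B ^ 2 ≤ Y)
    (hB : ∀ ω i, ∀ w ∈ init ω i, w + 1 < B) (hN : ∀ ω, (∑ i, init ω i).card ≤ cap * M) :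
    ∃ D', Reach S (Y ^ 8) (1 + (2 * L + 3)) init D' ∧ Stored cap (fun ω => ∑ i, init ω i) D' := by
  have hYY : Y ≤ Y ^ 8 := Nat.le_self_pow (by norm_num) Y
  set D : Ω → Fin M → Multiset ℕ := fun ω i => packList (init ω i).toList with hD
  have hu : ∀ ω i, unpack (D ω i) = init ω i := by
    intro ω i
    rw [hD, unpack_packList, Multiset.coe_toList]
  have hc : ∀ ω i, (D ω i).card ≤ Sd := by
    intro ω i
    have h1 := card_packList_le (init ω i).toList
    have h2 := hcard ω i
    rw [Multiset.length_toList] at h1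
    have h3 : (init ω i).card / 2 ≤ S / 2 := Nat.div_le_div_right h2
    simp only [hD]
    omega
  have hDY : ∀ ω i, ∀ w ∈ D ω i, w < Y := by
    intro ω i w hw
    exact (lt_of_mem_packList _ (fun w hw => hB ω i w (by simpa using hw)) w hw).trans_le hBY
  obtain ⟨D', hr, hD'⟩ := sort_pass p.toScanParams p.cap_pos (p.cap_le.trans p.data_le_space)
    p.cap_mul_lt unpack (fun _ => 0) (fun _ => 0) D hc hDY
    (fun ω i => by rw [hu]; exact hcard ω i)
    (fun ω i w hw => by
      rw [hu] at hw
      exact (((Nat.lt_succ_self w).trans (hB ω i w hw)).trans_le (nat_le_sq B)).trans_le hBY)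
    (fun ω => by simp only [hu]; exact hN ω)
    (fun ω i w _ => p.counters_pos) (fun _ _ _ _ _ _ _ _ => le_rfl)
  refine ⟨D', .trans (MPCStep.local (fun _ s => packList s.toList) (fun _ _ => rfl)
    (fun ω i => (hc ω i).trans p.data_le_space)
    (fun ω i w hw => (hDY ω i w hw).trans_le hYY)).reach hr,
    fun ω => ?_, fun ω => (hD' ω).2.1⟩
  rw [(hD' ω).1]
  simp only [hu]

end Stored

/-! ### A small separating family of bipartitions -/

section HashFamily

/-- Prescribing two values leaves a product set in which two of the `Z` factors shrink from two
elements to one. -/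
theorem card_separating {Z : ℕ} (u v : Fin Z) (huv : u ≠ v) :
    4 * (Finset.univ.filter (fun h : Fin Z → Bool => h u = true ∧ h v = false)).card = 2 ^ Z := by
  have h1 : Finset.univ.filter (fun h : Fin Z → Bool => h u = true ∧ h v = false) =
      Fintype.piFinset (fun x => if x = u then {true} else if x = v then {false} else
        (Finset.univ : Finset Bool)) := by
    ext h
    simp only [Finset.mem_filter, Finset.mem_univ, true_and, Fintype.mem_piFinset]
    constructor
    · rintro ⟨h1, h2⟩ x
      split_ifs with hx hx'
      · simp [hx, h1]
      · simp [hx', h2]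
      · simp
    · intro hx
      have h1 := hx u
      have h2 := hx v
      simpa [huv.symm] using And.intro h1 h2
  have h2 : ∀ x : Fin Z, (if x = u then ({true} : Finset Bool) else if x = v then {false} else
      Finset.univ).card * ((if x = u then 2 else 1) * (if x = v then 2 else 1)) = 2 := by
    intro x
    by_cases hx : x = u
    · subst hx
      simp [huv]
    · by_cases hx' : x = v
      · subst hx'
        simp [hx]
      · simp [hx, hx']
  have h3 := Finset.prod_congr (rfl : (Finset.univ : Finset (Fin Z)) = Finset.univ)
    (fun x _ => h2 x)
  rw [Finset.prod_mul_distrib, Finset.prod_mul_distrib, ← Fintype.card_piFinset, ← h1] at h3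
  simp only [Finset.prod_ite_eq', Finset.mem_univ, if_true, Finset.prod_const, Finset.card_univ,
    Fintype.card_fin] at h3
  omega

/-- Averaged over all bipartitions, the factor of each pair is `1 - 1/2 * 1/4 = 7/8`, so some
bipartition does at least as well. -/
theorem exists_separating {Z : ℕ} (w : Fin Z × Fin Z → ℝ) :
    ∃ h : Fin Z → Bool, ∑ p ∈ (Finset.univ : Finset (Fin Z)).offDiag,
      (if h p.1 = true ∧ h p.2 = false then 1 / 2 else 1) * w p ≤
        7 / 8 * ∑ p ∈ (Finset.univ : Finset (Fin Z)).offDiag, w p := by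
  have := Finset.exists_le_of_sum_le (s := (Finset.univ : Finset (Fin Z → Bool)))
    (f := fun h : Fin Z → Bool => ∑ p ∈ (Finset.univ : Finset (Fin Z)).offDiag,
      (if h p.1 = true ∧ h p.2 = false then 1 / 2 else 1) * w p)
    (g := fun _ => 7 / 8 * ∑ p ∈ (Finset.univ : Finset (Fin Z)).offDiag, w p)
    Finset.univ_nonempty (by
      rw [Finset.sum_comm, Finset.sum_const, Finset.card_univ, Fintype.card_fun, Fintype.card_bool,
        Fintype.card_fin, nsmul_eq_mul, Finset.mul_sum, Finset.mul_sum]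
      refine (Finset.sum_congr rfl fun p hp => ?_).le
      have hc := card_separating p.1 p.2 (Finset.mem_offDiag.1 hp).2.2
      have hc' : (4 : ℝ) * (Finset.univ.filter
          (fun h : Fin Z → Bool => h p.1 = true ∧ h p.2 = false)).card = 2 ^ Z := by
        exact_mod_cast hc
      have hs : ∀ h : Fin Z → Bool, (if h p.1 = true ∧ h p.2 = false then (1 / 2 : ℝ) else 1) =
          1 - 1 / 2 * (if h p.1 = true ∧ h p.2 = false then 1 else 0) := by
        intro h
        split_ifs <;> norm_num
      rw [← Finset.sum_mul, Finset.sum_congr rfl fun h _ => hs h, Finset.sum_sub_distrib,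
        ← Finset.mul_sum, Finset.sum_boole, Finset.sum_const, Finset.card_univ, Fintype.card_fun,
        Fintype.card_bool, Fintype.card_fin, nsmul_eq_mul]
      push_cast
      rw [← hc']
      ring)
  obtain ⟨h, -, hh⟩ := this
  exact ⟨h, hh⟩

/-- Greedy derandomization: the potential sums `2 ^ (-X)` over ordered pairs, where `X` is the
number of members separating the pair. It starts below `Z ^ 2`, and a well-chosen new member
multiplies it by at most `7/8`. -/
theorem exists_family_potential (Z T : ℕ) :
    ∃ h : Fin T → Fin Z → Bool, ∑ p ∈ (Finset.univ : Finset (Fin Z)).offDiag,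
      ∏ s, (if h s p.1 = true ∧ h s p.2 = false then (1 / 2 : ℝ) else 1) ≤
        (7 / 8) ^ T * (Z : ℝ) ^ 2 := by
  induction T with
  | zero =>
    refine ⟨fun s => s.elim0, ?_⟩
    have : (Finset.univ : Finset (Fin Z)).offDiag.card ≤ Z ^ 2 := by
      rw [Finset.offDiag_card, Finset.card_univ, Fintype.card_fin, sq]
      exact Nat.sub_le _ _
    simpa using (by exact_mod_cast this :
      ((Finset.univ : Finset (Fin Z)).offDiag.card : ℝ) ≤ (Z : ℝ) ^ 2)
  | succ T ih =>
    obtain ⟨h, hh⟩ := ih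
    obtain ⟨h', hh'⟩ := exists_separating (fun p : Fin Z × Fin Z =>
      ∏ s, (if h s p.1 = true ∧ h s p.2 = false then (1 / 2 : ℝ) else 1))
    refine ⟨Fin.cons h' h, ?_⟩
    simp only [Fin.prod_univ_succ, Fin.cons_zero, Fin.cons_succ]
    refine hh'.trans ?_
    rw [pow_succ]
    linarith

/-- A small family of bipartitions such that every ordered pair of numbers is separated in the
right direction by a constant fraction of them. -/
theorem exists_hash_family {Z T : ℕ} (hT : Z ^ 200 < 2 ^ T) :
    ∃ h : Fin T → ℕ → Bool, ∀ u < Z, ∀ v < Z, u ≠ v →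
      T ≤ 100 * (Finset.univ.filter (fun s => h s u = true ∧ h s v = false)).card := by
  obtain ⟨h, hh⟩ := exists_family_potential Z T
  refine ⟨fun s u => if hu : u < Z then h s ⟨u, hu⟩ else false, fun u hu v hv huv => ?_⟩
  simp only [hu, hv, dif_pos]
  -- If `100 * X < T`, then `2 ^ (-T) ≤ (2 ^ (-X)) ^ 100 ≤ (7/8) ^ (100 * T) * Z ^ 200 < (2 * (7/8)
  -- ^ 100) ^ T ≤ 2 ^ (-T)`, the last step because `(7/8) ^ 100 ≤ 1/4`.
  by_contra hlt
  set X := (Finset.univ.filter (fun s => h s ⟨u, hu⟩ = true ∧ h s ⟨v, hv⟩ = false)).card with hX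
  have h1 : (1 / 2 : ℝ) ^ X ≤ (7 / 8) ^ T * (Z : ℝ) ^ 2 := by
    refine le_trans ?_ hh
    have := Finset.single_le_sum (s := (Finset.univ : Finset (Fin Z)).offDiag)
      (f := fun p => ∏ s, (if h s p.1 = true ∧ h s p.2 = false then (1 / 2 : ℝ) else 1))
      (fun p _ => Finset.prod_nonneg fun s _ => by split_ifs <;> norm_num)
      (a := (⟨u, hu⟩, ⟨v, hv⟩)) (by simp [huv])
    refine le_trans (le_of_eq ?_) this
    rw [Finset.prod_ite, Finset.prod_const, Finset.prod_const_one, mul_one]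
  have h2 : (1 / 2 : ℝ) ^ T ≤ ((1 / 2 : ℝ) ^ X) ^ 100 := by
    rw [← pow_mul]
    exact pow_le_pow_of_le_one (by norm_num) (by norm_num) (by omega)
  have h3 : ((1 / 2 : ℝ) ^ X) ^ 100 ≤ ((7 / 8) ^ 100) ^ T * (Z : ℝ) ^ 200 := by
    refine (pow_le_pow_left₀ (by positivity) h1 100).trans (le_of_eq ?_)
    rw [mul_pow, ← pow_mul, ← pow_mul, ← pow_mul, mul_comm T 100]
  have h4 : (Z : ℝ) ^ 200 < 2 ^ T := by exact_mod_cast hT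
  have h5 : ((7 / 8 : ℝ) ^ 100) ^ T * (Z : ℝ) ^ 200 < ((7 / 8) ^ 100) ^ T * 2 ^ T :=
    mul_lt_mul_of_pos_left h4 (by positivity)
  have h6 : ((7 / 8 : ℝ) ^ 100) ^ T * 2 ^ T ≤ (1 / 2) ^ T := by
    rw [← mul_pow]
    exact pow_le_pow_left₀ (by positivity) (by norm_num) T
  linarith

end HashFamily

/-! ### Simultaneous contractions and the encoding of graphs -/

namespace FinGraph

/-- No target is itself in the list, so earlier contractions touch neither a later `u` nor `f u`:
the edge between them survives, and the successive relabellings compose to a single map. -/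
theorem exists_contractsTo (f : ℕ → ℕ) (us : List ℕ) (G : FinGraph) (hnd : us.Nodup)
    (hf : ∀ u ∈ us, f u ∉ us) (hadj : ∀ u ∈ us, G.graph.Adj u (f u)) :
    ∃ H, ContractsTo G (us.map fun u => (u, f u)) H ∧ H.verts = G.verts \ us.toFinset ∧
      H.graph = G.graph.map (fun x => if x ∈ us then f x else x) := by
  induction us generalizing G with
  | nil =>
    refine ⟨G, .nil G, by simp, ?_⟩
    ext a b
    simp only [List.not_mem_nil, if_false, SimpleGraph.map_adj']
    refine ⟨fun h => ⟨h.ne, a, b, h, rfl, rfl⟩, ?_⟩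
    rintro ⟨-, x, y, h, rfl, rfl⟩
    exact h
  | cons u us ih =>
    obtain ⟨hu, hnd'⟩ := List.nodup_cons.1 hnd
    have hau := hadj u (by simp)
    obtain ⟨H, hc, hv, hg⟩ := ih (G.contract u (f u) hau) hnd'
      (fun v hv h => hf v (by simp [hv]) (by simp [h])) (by
        intro v hv
        have h1 : v ≠ u := fun h => hu (h ▸ hv)
        have h2 : f v ≠ u := fun h => hf v (by simp [hv]) (by simp [h])
        have h3 := hadj v (by simp [hv])
        simp only [contract, SimpleGraph.map_adj']
        exact ⟨h3.ne, v, f v, h3, by simp [h1], by simp [h2]⟩)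
    refine ⟨H, .cons hau hc, ?_, ?_⟩
    · rw [hv]
      ext x
      simp only [contract, Finset.mem_sdiff, Finset.mem_erase, List.mem_toFinset, List.mem_cons]
      tauto
    · rw [hg]
      ext a b
      have hcomp : ∀ x, (if (if x = u then f u else x) ∈ us then f (if x = u then f u else x)
          else (if x = u then f u else x)) = if x ∈ u :: us then f x else x := by
        intro x
        by_cases hx : x = u
        · subst hx
          have : f x ∉ us := fun h => hf x (by simp) (by simp [h])
          simp [this]
        · simp [hx]
      simp only [contract, SimpleGraph.map_adj']
      constructor
      · rintro ⟨hab, x, y, ⟨-, x', y', hxy, rfl, rfl⟩, rfl, rfl⟩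
        exact ⟨hab, x', y', hxy, (hcomp x').symm, (hcomp y').symm⟩
      · rintro ⟨hab, x', y', hxy, rfl, rfl⟩
        refine ⟨hab, _, _, ⟨?_, x', y', hxy, rfl, rfl⟩, hcomp x', hcomp y'⟩
        intro h
        rw [← hcomp x', ← hcomp y', h] at hab
        exact hab rfl

/-- Contraction of all vertices that are moved by an idempotent map along edges. -/
theorem exists_independentContraction (G : FinGraph) (f : ℕ → ℕ)
    (hadj : ∀ u ∈ G.verts, f u ≠ u → G.graph.Adj u (f u))
    (hidem : ∀ u ∈ G.verts, f (f u) = f u) :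
    ∃ H : FinGraph, G.IndependentContraction H ∧ H.verts = G.verts.filter (fun u => f u = u) ∧
      ∀ a b, H.graph.Adj a b ↔ a ≠ b ∧ ∃ x y, G.graph.Adj x y ∧ f x = a ∧ f y = b := by
  have hmem : ∀ u, u ∈ (G.verts.filter (fun u => f u ≠ u)).toList ↔ u ∈ G.verts ∧ f u ≠ u := by
    simp
  obtain ⟨H, hc, hv, hg⟩ := G.exists_contractsTo f (G.verts.filter (fun u => f u ≠ u)).toList
    (Finset.nodup_toList _)
    (fun u hu h => ((hmem _).1 h).2 (hidem u ((hmem u).1 hu).1))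
    (fun u hu => hadj u ((hmem u).1 hu).1 ((hmem u).1 hu).2)
  refine ⟨H, ⟨_, ?_, ?_, hc⟩, ?_, ?_⟩
  · intro p hp
    obtain ⟨u, hu, rfl⟩ := List.mem_map.1 hp
    exact hadj u ((hmem u).1 hu).1 ((hmem u).1 hu).2
  · intro p hp q hq
    obtain ⟨u, hu, rfl⟩ := List.mem_map.1 hp
    obtain ⟨v, hv, rfl⟩ := List.mem_map.1 hq
    intro h
    have h1 := ((hmem v).1 hv).2
    simp only at h
    rw [h] at h1
    exact h1 (hidem u ((hmem u).1 hu).1)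
  · rw [hv]
    ext u
    simp only [Finset.mem_sdiff, Finset.mem_filter, List.mem_toFinset, hmem]
    tauto
  · intro a b
    rw [hg, SimpleGraph.map_adj']
    have hval : ∀ x ∈ G.verts,
        (if x ∈ (G.verts.filter (fun u => f u ≠ u)).toList then f x else x) = f x := by
      intro x hx
      simp only [hmem]
      split_ifs with h
      · rfl
      · by_contra h'
        exact h ⟨hx, fun h => h' h.symm⟩
    refine and_congr_right fun _ => exists_congr fun x => exists_congr fun y =>
      and_congr_right fun hxy => ?_
    rw [hval x (G.support_subset _ _ hxy), hval y (G.support_subset _ _ hxy.symm)]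

theorem mem_encode {G : FinGraph} {w : ℕ} : w ∈ G.encode ↔
    (∃ u ∈ G.verts, Nat.pair u u = w) ∨
      ∃ u v, G.graph.Adj u v ∧ Nat.pair (min u v) (max u v) = w := by
  simp only [encode, Multiset.mem_add, Multiset.mem_map, Finset.mem_val, mem_edges]
  refine or_congr_right ⟨?_, ?_⟩
  · rintro ⟨e, he, rfl⟩
    induction e using Sym2.ind with
    | _ u v => exact ⟨u, v, he, by simp⟩
  · rintro ⟨u, v, h, rfl⟩
    exact ⟨s(u, v), h, by simp⟩

/-- Vertex words are pairs with equal entries and edge words have strictly increasing entries, so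
the two kinds never collide. Consequently a graph's encoding can be recovered by removing
repetitions. -/
theorem nodup_encode (G : FinGraph) : G.encode.Nodup := by
  rw [encode, Multiset.nodup_add]
  refine ⟨Multiset.Nodup.map (fun a b h => (Nat.pair_eq_pair.1 h).1) G.verts.nodup,
    Multiset.Nodup.map_on ?_ G.edges.nodup, ?_⟩
  · intro e _ e' _ h
    induction e using Sym2.ind with
    | _ a b =>
      induction e' using Sym2.ind with
      | _ c d =>
        simp only [Sym2.inf_mk, Sym2.sup_mk, Nat.pair_eq_pair] at h
        rw [Sym2.eq_iff]
        omega
  · rw [Multiset.disjoint_left]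
    intro w hw hw'
    obtain ⟨u, -, rfl⟩ := Multiset.mem_map.1 hw
    obtain ⟨e, he, h⟩ := Multiset.mem_map.1 hw'
    rw [Finset.mem_val, mem_edges] at he
    induction e using Sym2.ind with
    | _ a b =>
      simp only [Sym2.inf_mk, Sym2.sup_mk, Nat.pair_eq_pair] at h
      have := G.graph.ne_of_adj he
      omega

theorem card_encode (G : FinGraph) : G.encode.card = G.n + G.m := by
  simp [encode, n, m]

theorem m_le (G : FinGraph) : G.m ≤ G.n ^ 2 := by
  have h1 : G.edges ⊆ G.verts.sym2 := by
    classical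
    simp only [edges]
    exact Finset.filter_subset _ _
  have h2 := Finset.card_le_card h1
  rw [Finset.card_sym2] at h2
  refine h2.trans ?_
  show (G.n + 1).choose 2 ≤ G.n ^ 2
  rw [Nat.choose_two_right, Nat.add_sub_cancel]
  refine Nat.div_le_of_le_mul ?_
  nlinarith [Nat.le_self_pow (two_ne_zero) G.n]

end FinGraph

/-! ### Arcs, least neighbours, and counting contracted vertices -/

namespace FinGraph

/-- The two arcs of the edge that is described by a word. -/
def arcsOfWord (w : ℕ) : Multiset ℕ :=
  if w.unpair.1 = w.unpair.2 then 0
  else {Nat.pair w.unpair.1 w.unpair.2, Nat.pair w.unpair.2 w.unpair.1}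

/-- The words for the arcs of a graph. -/
noncomputable def arcWords (G : FinGraph) : Multiset ℕ := G.encode.bind arcsOfWord

/-- The least neighbour of a vertex. -/
noncomputable def leastNeighbor (G : FinGraph) (u : ℕ) : ℕ := sInf {v | G.graph.Adj u v}

theorem card_arcsOfWord_le (w : ℕ) : (arcsOfWord w).card ≤ 2 := by
  rw [arcsOfWord]
  split_ifs <;> simp

theorem card_arcWords_le (G : FinGraph) : G.arcWords.card ≤ 2 * G.encode.card := by
  rw [arcWords, Multiset.card_bind]
  have h1 := Multiset.sum_le_card_nsmul (G.encode.map (Multiset.card ∘ arcsOfWord)) 2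
    (by simpa using fun w _ => card_arcsOfWord_le w)
  simp only [Multiset.card_map, smul_eq_mul] at h1
  omega

theorem mem_arcWords {G : FinGraph} {w : ℕ} :
    w ∈ G.arcWords ↔ ∃ u v, G.graph.Adj u v ∧ Nat.pair u v = w := by
  rw [arcWords, Multiset.mem_bind]
  constructor
  · rintro ⟨x, hx, hw⟩
    rcases mem_encode.1 hx with ⟨u, -, rfl⟩ | ⟨u, v, h, rfl⟩
    · simp [arcsOfWord] at hw
    · rcases le_total u v with huv | huv
      · simp only [arcsOfWord, Nat.unpair_pair, min_eq_left huv, max_eq_right huv, h.ne, if_false,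
          Multiset.insert_eq_cons, Multiset.mem_cons, Multiset.mem_singleton] at hw
        rcases hw with rfl | rfl
        · exact ⟨u, v, h, rfl⟩
        · exact ⟨v, u, h.symm, rfl⟩
      · simp only [arcsOfWord, Nat.unpair_pair, min_eq_right huv, max_eq_left huv, h.ne', if_false,
          Multiset.insert_eq_cons, Multiset.mem_cons, Multiset.mem_singleton] at hw
        rcases hw with rfl | rfl
        · exact ⟨v, u, h.symm, rfl⟩
        · exact ⟨u, v, h, rfl⟩
  · rintro ⟨u, v, h, rfl⟩
    refine ⟨_, mem_encode.2 (.inr ⟨u, v, h, rfl⟩), ?_⟩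
    rcases le_total u v with huv | huv
    · simp [arcsOfWord, min_eq_left huv, max_eq_right huv, h.ne]
    · simp [arcsOfWord, min_eq_right huv, max_eq_left huv, h.ne']

theorem nodup_arcWords (G : FinGraph) : G.arcWords.Nodup := by
  rw [arcWords, Multiset.nodup_bind]
  constructor
  · intro w _
    rw [arcsOfWord]
    split_ifs with h
    · simp
    · simp only [Multiset.insert_eq_cons, Multiset.nodup_cons, Multiset.mem_singleton,
        Multiset.nodup_singleton, and_true, Nat.pair_eq_pair]
      exact fun h' => h h'.1
  · refine G.nodup_encode.pairwise ?_
    intro x hx y hy hxy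
    rw [Function.onFun, Multiset.disjoint_left]
    intro w hwx hwy
    have hle : ∀ z ∈ G.encode, z.unpair.1 ≤ z.unpair.2 := by
      intro z hz
      rcases mem_encode.1 hz with ⟨u, -, rfl⟩ | ⟨u, v, -, rfl⟩ <;> simp
    have key : ∀ z ∈ G.encode, w ∈ arcsOfWord z →
        z = Nat.pair (min w.unpair.1 w.unpair.2) (max w.unpair.1 w.unpair.2) := by
      intro z hz hw
      have h1 := hle z hz
      rw [arcsOfWord] at hw
      split_ifs at hw
      · simp at hw
      · simp only [Multiset.insert_eq_cons, Multiset.mem_cons, Multiset.mem_singleton] at hw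
        rcases hw with rfl | rfl
        · simp [h1]
        · simp [h1]
    exact hxy ((key x hx hwx).trans (key y hy hwy).symm)

theorem adj_leastNeighbor {G : FinGraph} {u v : ℕ} (h : G.graph.Adj u v) :
    G.graph.Adj u (G.leastNeighbor u) :=
  Nat.sInf_mem (s := {v | G.graph.Adj u v}) ⟨v, h⟩

/-- The vertex into which `u` is contracted when the vertices are bipartitioned by `c`. -/
noncomputable def target (G : FinGraph) (c : ℕ → Bool) (u : ℕ) : ℕ :=
  if c u = true ∧ c (G.leastNeighbor u) = false then G.leastNeighbor u else u

/-- A least neighbour is used as a target only if it is on the `false` side, and such vertices stay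
put. -/
theorem target_target (G : FinGraph) (c : ℕ → Bool) (u : ℕ) :
    G.target c (G.target c u) = G.target c u := by
  by_cases h : c u = true ∧ c (G.leastNeighbor u) = false
  · have h1 : G.target c u = G.leastNeighbor u := if_pos h
    rw [h1, target, if_neg]
    simp [h.2]
  · have h1 : G.target c u = u := if_neg h
    rw [h1, h1]

theorem target_mem {G : FinGraph} (hG : G.NoIsolated) (c : ℕ → Bool) {u : ℕ} (hu : u ∈ G.verts) :
    G.target c u ∈ G.verts := by
  rw [target]
  split_ifs
  · obtain ⟨v, hv⟩ := hG u hu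
    exact G.support_subset _ _ (adj_leastNeighbor hv).symm
  · exact hu

/-- The vertices that are contracted when the vertices are bipartitioned by `c`. -/
noncomputable def moved (G : FinGraph) (c : ℕ → Bool) : Finset ℕ :=
  G.verts.filter fun u => c u = true ∧ c (G.leastNeighbor u) = false

/-- The words that describe the contracted graph, with repetitions, for the edge `{u, v}`. -/
def edgeWords (a b : ℕ) : Multiset ℕ := {Nat.pair (min a b) (max a b), Nat.pair a a, Nat.pair b b}

/-- The arcs alone determine the new encoding: without isolated vertices, every surviving vertex is
the end of an arc. A loop produces the word of a vertex, which is listed anyway, and parallel edges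
produce equal words, so removing repetitions is the only cleanup required. The separate vertex words
keep vertices that become isolated. -/
theorem exists_contracted (G : FinGraph) (hG : G.NoIsolated) (c : ℕ → Bool) :
    ∃ H : FinGraph, G.IndependentContraction H ∧ H.n + (G.moved c).card = G.n ∧
      (G.arcWords.bind fun w => edgeWords (G.target c w.unpair.1) (G.target c w.unpair.2)).dedup =
        H.encode := by
  have hmove : ∀ u ∈ G.verts, (G.target c u ≠ u ↔
      c u = true ∧ c (G.leastNeighbor u) = false) := by
    intro u hu
    obtain ⟨v, hv⟩ := hG u hu
    have h1 := (adj_leastNeighbor hv).ne'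
    rw [target]
    split_ifs with h
    · exact ⟨fun _ => h, fun _ => h1⟩
    · exact ⟨fun h' => absurd rfl h', fun h' => absurd h' h⟩
  obtain ⟨H, hi, hv, ha⟩ := G.exists_independentContraction (G.target c)
    (fun u hu h => by
      obtain ⟨v, hv⟩ := hG u hu
      rw [target, if_pos ((hmove u hu).1 h)]
      exact adj_leastNeighbor hv)
    (fun u _ => G.target_target c u)
  refine ⟨H, hi, ?_, ?_⟩
  · have h1 : G.moved c = G.verts.filter fun u => ¬ G.target c u = u :=
      Finset.filter_congr fun u hu => (hmove u hu).symm
    rw [n, n, hv, h1]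
    exact Finset.card_filter_add_card_filter_not _
  · refine (Multiset.Nodup.ext (Multiset.nodup_dedup _) H.nodup_encode).2 fun w => ?_
    have hvm : ∀ u ∈ G.verts, G.target c u ∈ H.verts := by
      intro u hu
      rw [hv, Finset.mem_filter]
      exact ⟨target_mem hG c hu, G.target_target c u⟩
    rw [Multiset.mem_dedup, Multiset.mem_bind, mem_encode]
    constructor
    · rintro ⟨x, hx, hw⟩
      obtain ⟨u, v, huv, rfl⟩ := mem_arcWords.1 hx
      simp only [edgeWords, Nat.unpair_pair, Multiset.insert_eq_cons, Multiset.mem_cons,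
        Multiset.mem_singleton] at hw
      have hu := hvm u (G.support_subset _ _ huv)
      rcases hw with rfl | rfl | rfl
      · by_cases heq : G.target c u = G.target c v
        · refine .inl ⟨_, hu, ?_⟩
          rw [← heq, min_self, max_self]
        · exact .inr ⟨_, _, (ha _ _).2 ⟨heq, u, v, huv, rfl, rfl⟩, rfl⟩
      · exact .inl ⟨_, hu, rfl⟩
      · exact .inl ⟨_, hvm v (G.support_subset _ _ huv.symm), rfl⟩
    · rintro (⟨u, hu, rfl⟩ | ⟨a, b, hab, rfl⟩)
      · rw [hv, Finset.mem_filter] at hu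
        obtain ⟨v, huv⟩ := hG u hu.1
        refine ⟨_, mem_arcWords.2 ⟨u, v, huv, rfl⟩, ?_⟩
        simp [edgeWords, hu.2]
      · obtain ⟨-, x, y, hxy, rfl, rfl⟩ := (ha _ _).1 hab
        refine ⟨_, mem_arcWords.2 ⟨x, y, hxy, rfl⟩, ?_⟩
        simp [edgeWords]

/-- Each contracted vertex `v` is charged to the single arc from its least neighbour to `v`. The
number of contracted vertices thus becomes a sum of local 0/1 contributions of the arcs. -/
theorem card_filter_arcWords {G : FinGraph} (hG : G.NoIsolated) (c : ℕ → Bool) :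
    (G.arcWords.map fun w => if w.unpair.1 = G.leastNeighbor w.unpair.2 ∧
      c w.unpair.2 = true ∧ c (G.leastNeighbor w.unpair.2) = false then 1 else 0).sum =
      (G.moved c).card := by
  have h1 : G.arcWords.filter (fun w => w.unpair.1 = G.leastNeighbor w.unpair.2 ∧
      c w.unpair.2 = true ∧ c (G.leastNeighbor w.unpair.2) = false) =
      (G.moved c).val.map fun u => Nat.pair (G.leastNeighbor u) u := by
    refine (Multiset.Nodup.ext (G.nodup_arcWords.filter _)
      ((G.moved c).nodup.map fun a b h => (Nat.pair_eq_pair.1 h).2)).2 fun w => ?_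
    simp only [Multiset.mem_filter, mem_arcWords, Multiset.mem_map, Finset.mem_val, moved,
      Finset.mem_filter]
    constructor
    · rintro ⟨⟨u, v, huv, rfl⟩, h1, h2⟩
      simp only [Nat.unpair_pair] at h1 h2
      exact ⟨v, ⟨G.support_subset _ _ huv.symm, h2⟩, by rw [← h1]⟩
    · rintro ⟨v, ⟨hv, h2⟩, rfl⟩
      obtain ⟨u, huv⟩ := hG v hv
      exact ⟨⟨_, v, (adj_leastNeighbor huv).symm, rfl⟩, by simp, by simpa using h2⟩
  have h2 := congrArg Multiset.card h1
  rw [Multiset.card_map, Finset.card_val] at h2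
  rw [← h2, ← Multiset.countP_eq_card_filter]
  generalize G.arcWords = s
  induction s using Multiset.induction_on with
  | empty => simp
  | cons a s ih => rw [Multiset.map_cons, Multiset.sum_cons, ih, Multiset.countP_cons, add_comm]

/-- Double counting of pairs of a vertex and a bipartition that moves it: each vertex contributes at
least `Q / 100`, so the average over the `Q` bipartitions, and hence the maximum, is at least `n /
100`. -/
theorem card_le_card_moved {G : FinGraph} (hG : G.NoIsolated) {Q Z : ℕ} (h : Fin Q → ℕ → Bool)
    (hh : ∀ u < Z, ∀ v < Z, u ≠ v →
      Q ≤ 100 * (Finset.univ.filter (fun s => h s u = true ∧ h s v = false)).card)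
    (hZ : ∀ u ∈ G.verts, u < Z) (d : Fin Q)
    (hd : ∀ d', (G.moved (h d')).card ≤ (G.moved (h d)).card) :
    G.n ≤ 100 * (G.moved (h d)).card := by
  have h1 : ∑ d', (G.moved (h d')).card = ∑ u ∈ G.verts, (Finset.univ.filter
      (fun s => h s u = true ∧ h s (G.leastNeighbor u) = false)).card := by
    simp only [moved, Finset.card_filter]
    exact Finset.sum_comm
  have h2 : G.n * Q ≤ 100 * ∑ d', (G.moved (h d')).card := by
    rw [h1, Finset.mul_sum]
    refine Finset.card_nsmul_le_sum G.verts _ Q fun u hu => ?_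
    obtain ⟨v, hv⟩ := hG u hu
    have ha := adj_leastNeighbor hv
    exact hh u (hZ u hu) _ (hZ _ (G.support_subset _ _ ha.symm)) ha.ne
  have h3 := Finset.sum_le_card_nsmul Finset.univ (fun d' => (G.moved (h d')).card) _
    (fun d' _ => hd d')
  rw [Finset.card_univ, Fintype.card_fin, smul_eq_mul] at h3
  have hQ : 0 < Q := d.pos
  refine Nat.le_of_mul_le_mul_right (h2.trans ?_) hQ
  calc 100 * ∑ d', (G.moved (h d')).card ≤ 100 * (Q * (G.moved (h d)).card) :=
        Nat.mul_le_mul_left _ h3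
    _ = _ := by ring

end FinGraph

/-! ### The contraction algorithm -/

section Algorithm

variable {M Q F L S Sd Y cap : ℕ} {Ω : Type}

/-- The number of rounds of the contraction algorithm, for trees of depth `L` and sorting in `P`
passes. -/
def contractionRounds (L P : ℕ) : ℕ :=
  1 + (2 * L + 3) + (2 * L + 3) + (P * (2 * L + 3) + (2 * L + 3)) +
    (P * (2 * L + 3) + (2 * L + 3)) + (2 * L + 3) + (2 * L + 3) + (P * (2 * L + 3) + (2 * L + 3))

/-- The factor `6` in `hN` is the largest expansion: two arcs per edge, each finally replaced by
three words. The power `B ^ 32` covers all intermediate words: nested pairing takes arcs annotated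
with one least neighbour to `B ^ 4`, with both to `B ^ 8`, and with the chosen bipartition to `B ^
16`. -/
theorem contraction_reach (p : NetParams M Q F L S Sd Y cap) (hS : S / 2 + 1 ≤ Sd)
    {Z P B : ℕ} (hB : 2 ≤ B) (hZB : Z ≤ B) (hQB : Q ≤ B) (hBY : B ^ 32 ≤ Y) (hP : Z ^ 2 ≤ Q ^ P)
    (h : Fin Q → ℕ → Bool)
    (hh : ∀ u < Z, ∀ v < Z, u ≠ v →
      Q ≤ 100 * (Finset.univ.filter (fun s => h s u = true ∧ h s v = false)).card)
    (G : Ω → FinGraph) (hG : ∀ ω, (G ω).NoIsolated) (hGZ : ∀ ω, ∀ u ∈ (G ω).verts, u < Z)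
    (hN : ∀ ω, 6 * ((G ω).n + (G ω).m) ≤ cap * M)
    (init : Ω → Fin M → Multiset ℕ) (hsum : ∀ ω, ∑ i, init ω i = (G ω).encode)
    (hcard : ∀ ω i, (init ω i).card ≤ S) :
    ∃ D : Ω → Fin M → Multiset ℕ, Reach S (Y ^ 8) (contractionRounds L P) init D ∧
      ∀ ω, ∃ H : FinGraph, ∑ i, D ω i = H.encode ∧ (G ω).IndependentContraction H ∧
        100 * H.n ≤ 99 * (G ω).n := by
  have hBpow : ∀ a b, a ≤ b → B ^ a ≤ B ^ b := fun a b hab => Nat.pow_le_pow_right (by omega) hab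
  have hpair : ∀ {a b} (x : ℕ), a < B ^ x → b < B ^ x → Nat.pair a b < B ^ (2 * x) := by
    intro a b x ha hb
    rw [mul_comm, pow_mul]
    exact pair_lt_sq ha hb
  have hlift : ∀ {a} (x y : ℕ), x ≤ y → a < B ^ x → a < B ^ y := fun x y hxy ha =>
    ha.trans_le (hBpow x y hxy)
  have hYlt : ∀ {a} (x : ℕ), x ≤ 32 → a < B ^ x → a < Y := fun x hx ha =>
    (hlift x 32 hx ha).trans_le hBY
  have hadjZ : ∀ ω u v, (G ω).graph.Adj u v → u < Z ∧ v < Z := fun ω u v huv =>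
    ⟨hGZ ω u ((G ω).support_subset _ _ huv), hGZ ω v ((G ω).support_subset _ _ huv.symm)⟩
  have hZ1 : ∀ {a}, a < Z → a < B ^ 1 := fun ha => by rw [pow_one]; exact ha.trans_le hZB
  have hencZ : ∀ ω, ∀ w ∈ (G ω).encode, w < Z ^ 2 := by
    intro ω w hw
    rcases FinGraph.mem_encode.1 hw with ⟨u, hu, rfl⟩ | ⟨u, v, huv, rfl⟩
    · exact pair_lt_sq (hGZ ω u hu) (hGZ ω u hu)
    · have := hadjZ ω u v huv
      exact pair_lt_sq (by omega) (by omega)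
  have hencB : ∀ ω, ∀ w ∈ (G ω).encode, w < B ^ 2 := fun ω w hw =>
    (hencZ ω w hw).trans_le (Nat.pow_le_pow_left hZB 2)
  have harcZ : ∀ ω, ∀ w ∈ (G ω).arcWords, w.unpair.1 < Z ∧ w.unpair.2 < Z ∧
      (G ω).leastNeighbor w.unpair.1 < Z ∧ (G ω).leastNeighbor w.unpair.2 < Z := by
    intro ω w hw
    obtain ⟨u, v, huv, rfl⟩ := FinGraph.mem_arcWords.1 hw
    simp only [Nat.unpair_pair]
    exact ⟨(hadjZ ω u v huv).1, (hadjZ ω u v huv).2,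
      (hadjZ ω _ _ (FinGraph.adj_leastNeighbor huv)).2,
      (hadjZ ω _ _ (FinGraph.adj_leastNeighbor huv.symm)).2⟩
  have hZY : Z ^ 2 ≤ Y :=
    (Nat.pow_le_pow_left hZB 2).trans ((hBpow 2 32 (by norm_num)).trans hBY)
  -- balancing
  obtain ⟨D₀, r₀, s₀⟩ := balance p init hS hcard (B := B ^ 3)
    (by rw [← pow_mul]; exact (hBpow _ 32 (by norm_num)).trans hBY)
    (fun ω i w hw => by
      have hw' : w ∈ (G ω).encode := by
        rw [← hsum]
        exact Multiset.mem_sum.2 ⟨i, Finset.mem_univ _, hw⟩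
      have h1 := hencB ω w hw'
      have h2 : B ^ 2 * 2 ≤ B ^ 3 := by
        rw [pow_succ B 2]
        exact Nat.mul_le_mul_left _ hB
      omega)
    (fun ω => by
      rw [hsum, FinGraph.card_encode]
      have := hN ω
      omega)
  simp only [hsum] at s₀
  -- arcs
  obtain ⟨D₁, r₁, s₁⟩ := s₀.expand p (fun ω w hw => hYlt 2 (by norm_num) (hencB ω w hw))
    FinGraph.arcsOfWord (fun w => (FinGraph.card_arcsOfWord_le w).trans (by norm_num))
    (fun ω w hw x hx => by
      obtain ⟨u, v, huv, rfl⟩ := FinGraph.mem_arcWords.1 (Multiset.mem_bind.2 ⟨w, hw, hx⟩)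
      exact (pair_lt_sq (hadjZ ω u v huv).1 (hadjZ ω u v huv).2).trans_le hZY)
    (fun ω => by
      have h1 := (G ω).card_arcWords_le
      have h2 := hN ω
      rw [FinGraph.card_encode] at h1
      exact h1.trans (by omega))
  replace s₁ : Stored cap (fun ω => (G ω).arcWords) D₁ := s₁
  -- the least neighbour of the tail
  have hgm₁ : ∀ ω u, groupMin (fun w => w.unpair.1) (fun w => w.unpair.2) (G ω).arcWords u =
      (G ω).leastNeighbor u := by
    intro ω u
    rw [groupMin, FinGraph.leastNeighbor]
    congr 1
    ext v
    constructor
    · rintro ⟨w, hw, rfl, rfl⟩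
      obtain ⟨a, b, hab, rfl⟩ := FinGraph.mem_arcWords.1 hw
      simpa using hab
    · intro huv
      exact ⟨_, FinGraph.mem_arcWords.2 ⟨u, v, huv, rfl⟩, by simp⟩
  obtain ⟨D₂, r₂, s₂⟩ := s₁.annotate p
    (fun ω w hw => by
      obtain ⟨u, v, huv, rfl⟩ := FinGraph.mem_arcWords.1 hw
      exact (pair_lt_sq (hadjZ ω u v huv).1 (hadjZ ω u v huv).2).trans_le hZY)
    (fun w => w.unpair.1) (fun w => w.unpair.2) Z P (fun ω w hw => (harcZ ω w hw).1)
    (fun ω w hw => (harcZ ω w hw).2.1) hP hZY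
    (fun w a => Nat.pair (Nat.pair w.unpair.2 w.unpair.1) a)
    (fun ω w hw => by
      rw [hgm₁]
      have h1 := harcZ ω w hw
      exact hYlt 4 (by norm_num) (hpair 2 (hpair 1 (hZ1 h1.2.1) (hZ1 h1.1))
        (hlift 1 2 (by norm_num) (hZ1 h1.2.2.1))))
  simp only [hgm₁] at s₂
  -- the least neighbour of the head
  set item : FinGraph → ℕ → ℕ := fun G w =>
    Nat.pair (Nat.pair w.unpair.2 w.unpair.1) (G.leastNeighbor w.unpair.1) with hitem
  replace s₂ : Stored cap (fun ω => (G ω).arcWords.map (item (G ω))) D₂ := s₂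
  have hitemB : ∀ ω, ∀ w ∈ (G ω).arcWords, item (G ω) w < B ^ 4 := by
    intro ω w hw
    have h1 := harcZ ω w hw
    exact hpair 2 (hpair 1 (hZ1 h1.2.1) (hZ1 h1.1)) (hlift 1 2 (by norm_num) (hZ1 h1.2.2.1))
  have hgm₂ : ∀ ω v, groupMin (fun w => w.unpair.1.unpair.1) (fun w => w.unpair.1.unpair.2)
      ((G ω).arcWords.map (item (G ω))) v = (G ω).leastNeighbor v := by
    intro ω v
    rw [groupMin, FinGraph.leastNeighbor]
    congr 1
    ext u
    constructor
    · rintro ⟨x, hx, rfl, rfl⟩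
      obtain ⟨w, hw, rfl⟩ := Multiset.mem_map.1 hx
      obtain ⟨a, b, hab, rfl⟩ := FinGraph.mem_arcWords.1 hw
      simpa [hitem] using hab.symm
    · intro hvu
      exact ⟨_, Multiset.mem_map_of_mem _ (FinGraph.mem_arcWords.2 ⟨u, v, hvu.symm, rfl⟩),
        by simp [hitem]⟩
  obtain ⟨D₃, r₃, s₃⟩ := s₂.annotate p
    (fun ω x hx => by
      obtain ⟨w, hw, rfl⟩ := Multiset.mem_map.1 hx
      exact hYlt 4 (by norm_num) (hitemB ω w hw))
    (fun w => w.unpair.1.unpair.1) (fun w => w.unpair.1.unpair.2) Z P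
    (fun ω x hx => by
      obtain ⟨w, hw, rfl⟩ := Multiset.mem_map.1 hx
      simpa [hitem] using (harcZ ω w hw).2.1)
    (fun ω x hx => by
      obtain ⟨w, hw, rfl⟩ := Multiset.mem_map.1 hx
      simpa [hitem] using (harcZ ω w hw).1)
    hP hZY Nat.pair
    (fun ω x hx => by
      obtain ⟨w, hw, rfl⟩ := Multiset.mem_map.1 hx
      rw [hgm₂]
      refine hYlt 8 (by norm_num) (hpair 4 (hitemB ω w hw) (hlift 1 4 (by norm_num) (hZ1 ?_)))
      simpa [hitem] using (harcZ ω w hw).2.2.2)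
  simp only [hgm₂, Multiset.map_map] at s₃
  set item' : FinGraph → ℕ → ℕ := fun G w =>
    Nat.pair (item G w) (G.leastNeighbor w.unpair.2) with hitem'
  replace s₃ : Stored cap (fun ω => (G ω).arcWords.map (item' (G ω))) D₃ := by
    refine Eq.mp ?_ s₃
    congr 1
    funext ω
    refine Multiset.map_congr rfl fun w _ => ?_
    simp [hitem, hitem']
  have hitemB' : ∀ ω, ∀ w ∈ (G ω).arcWords, item' (G ω) w < B ^ 8 := fun ω w hw =>
    hpair 4 (hitemB ω w hw) (hlift 1 4 (by norm_num) (hZ1 (harcZ ω w hw).2.2.2))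
  -- the choice of the bipartition
  have hsel : ∃ sel : (Fin Q → ℕ) → Fin Q, ∀ (t : Fin Q → ℕ) (d : Fin Q), t d ≤ t (sel t) := by
    have : Nonempty (Fin Q) := ⟨⟨0, p.counters_pos⟩⟩
    choose sel hsel using fun t : Fin Q → ℕ => Finite.exists_max t
    exact ⟨sel, hsel⟩
  obtain ⟨sel, hsel⟩ := hsel
  obtain ⟨D₄, r₄, s₄⟩ := s₃.select p
    (fun ω x hx => by
      obtain ⟨w, hw, rfl⟩ := Multiset.mem_map.1 hx
      exact hYlt 8 (by norm_num) (hitemB' ω w hw))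
    (fun x d => if x.unpair.1.unpair.1.unpair.2 = x.unpair.2 ∧
      h d x.unpair.1.unpair.1.unpair.1 = true ∧ h d x.unpair.2 = false then 1 else 0)
    (fun x d => by split_ifs <;> simp) (fun t => (sel t).val)
    (fun ω t x hx => by
      obtain ⟨w, hw, rfl⟩ := Multiset.mem_map.1 hx
      refine hYlt 16 (by norm_num) (hpair 8 (hitemB' ω w hw) (hlift 1 8 (by norm_num) ?_))
      rw [pow_one]
      exact (sel t).2.trans_le hQB)
  -- The counter totals, summed over the annotated arcs, are the numbers of contracted vertices, so
  -- every arc learns the same optimal bipartition.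
  set best : Ω → Fin Q := fun ω => sel fun d => ((G ω).moved (h d)).card with hbest
  replace s₄ : Stored cap (fun ω => (G ω).arcWords.map fun w =>
      Nat.pair (item' (G ω) w) (best ω)) D₄ := by
    refine Eq.mp ?_ s₄
    congr 1
    funext ω
    rw [Multiset.map_map]
    refine Multiset.map_congr rfl fun w _ => ?_
    simp only [hbest, Function.comp_apply, Multiset.map_map]
    congr 3
    funext d
    rw [← FinGraph.card_filter_arcWords (hG ω)]
    simp [hitem, hitem']
  -- contraction
  set φ : ℕ → Multiset ℕ := fun x =>
    if hx : x.unpair.2 < Q then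
      FinGraph.edgeWords
        (if h ⟨_, hx⟩ x.unpair.1.unpair.1.unpair.1.unpair.2 = true ∧
            h ⟨_, hx⟩ x.unpair.1.unpair.1.unpair.2 = false then x.unpair.1.unpair.1.unpair.2
          else x.unpair.1.unpair.1.unpair.1.unpair.2)
        (if h ⟨_, hx⟩ x.unpair.1.unpair.1.unpair.1.unpair.1 = true ∧
            h ⟨_, hx⟩ x.unpair.1.unpair.2 = false then x.unpair.1.unpair.2
          else x.unpair.1.unpair.1.unpair.1.unpair.1)
    else 0 with hφ
  have hφval : ∀ ω w, φ (Nat.pair (item' (G ω) w) (best ω)) =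
      FinGraph.edgeWords ((G ω).target (h (best ω)) w.unpair.1)
        ((G ω).target (h (best ω)) w.unpair.2) := by
    intro ω w
    simp [hφ, hitem, hitem', FinGraph.target]
  have hcontr : ∀ ω, ((G ω).arcWords.map fun w => Nat.pair (item' (G ω) w) (best ω)).bind φ =
      (G ω).arcWords.bind fun w => FinGraph.edgeWords ((G ω).target (h (best ω)) w.unpair.1)
        ((G ω).target (h (best ω)) w.unpair.2) := by
    intro ω
    rw [Multiset.bind_map]
    simp only [hφval]
  have hφcard : ∀ x, (φ x).card ≤ 3 := by
    intro x
    simp only [hφ]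
    split_ifs <;> simp [FinGraph.edgeWords]
  have hedge : ∀ ω, ∀ w ∈ (G ω).arcWords, ∀ x ∈ FinGraph.edgeWords
      ((G ω).target (h (best ω)) w.unpair.1) ((G ω).target (h (best ω)) w.unpair.2), x < Z ^ 2 := by
    intro ω w hw x hx
    obtain ⟨u, v, huv, rfl⟩ := FinGraph.mem_arcWords.1 hw
    have h1 := hGZ ω _ (FinGraph.target_mem (hG ω) (h (best ω)) ((G ω).support_subset _ _ huv))
    have h2 := hGZ ω _ (FinGraph.target_mem (hG ω) (h (best ω)) ((G ω).support_subset _ _ huv.symm))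
    simp only [FinGraph.edgeWords, Nat.unpair_pair, Multiset.insert_eq_cons, Multiset.mem_cons,
      Multiset.mem_singleton] at hx
    rcases hx with rfl | rfl | rfl
    · exact pair_lt_sq (by omega) (by omega)
    · exact pair_lt_sq h1 h1
    · exact pair_lt_sq h2 h2
  obtain ⟨D₅, r₅, s₅⟩ := s₄.expand p
    (fun ω x hx => by
      obtain ⟨w, hw, rfl⟩ := Multiset.mem_map.1 hx
      refine hYlt 16 (by norm_num) (hpair 8 (hitemB' ω w hw) (hlift 1 8 (by norm_num) ?_))
      rw [pow_one]
      exact (best ω).2.trans_le hQB)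
    φ hφcard
    (fun ω x hx y hy => by
      obtain ⟨w, hw, rfl⟩ := Multiset.mem_map.1 hx
      rw [hφval] at hy
      exact (hedge ω w hw y hy).trans_le hZY)
    (fun ω => by
      rw [Multiset.card_bind]
      have h1 := Multiset.sum_le_card_nsmul
        (((G ω).arcWords.map fun w => Nat.pair (item' (G ω) w) (best ω)).map
          (Multiset.card ∘ φ)) 3 (by
            intro x hx
            obtain ⟨y, -, rfl⟩ := Multiset.mem_map.1 hx
            exact hφcard y)
      have h2 := (G ω).card_arcWords_le
      have h3 := hN ω
      rw [FinGraph.card_encode] at h2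
      rw [Multiset.card_map, Multiset.card_map, smul_eq_mul] at h1
      omega)
  simp only [hcontr] at s₅
  have hmemZ : ∀ ω, ∀ x ∈ (G ω).arcWords.bind fun w => FinGraph.edgeWords
      ((G ω).target (h (best ω)) w.unpair.1) ((G ω).target (h (best ω)) w.unpair.2), x < Z ^ 2 := by
    intro ω x hx
    obtain ⟨w, hw, hxw⟩ := Multiset.mem_bind.1 hx
    exact hedge ω w hw x hxw
  obtain ⟨D₆, r₆, s₆⟩ := s₅.dedup p
    (fun ω x hx => by
      have h1 := hmemZ ω x hx
      have h2 : Z ^ 2 ≤ B ^ 2 := Nat.pow_le_pow_left hZB 2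
      have h3 : B ^ 2 < B ^ 3 := Nat.pow_lt_pow_right (by omega) (by norm_num)
      exact hYlt 3 (by norm_num) (by omega))
    P (fun ω x hx => (hmemZ ω x hx).trans_le hP)
  refine ⟨D₆, (((((r₀.trans r₁).trans r₂).trans r₃).trans r₄).trans r₅).trans r₆, fun ω => ?_⟩
  obtain ⟨H, hi, hn, he⟩ := (G ω).exists_contracted (hG ω) (h (best ω))
  refine ⟨H, by rw [s₆.sum_eq, he], hi, ?_⟩
  have := FinGraph.card_le_card_moved (hG ω) h hh (hGZ ω) (best ω) 
    (hsel fun d => ((G ω).moved (h d)).card)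
  omega

end Algorithm

/-! ### Choice of parameters and the main theorem -/

theorem exists_root {n q : ℕ} (hn : 2 ≤ n) (hq : 2 ≤ q) :
    ∃ b, 2 ≤ b ∧ b ≤ n ∧ n ≤ b ^ q ∧ (b - 1) ^ q < n := by
  classical
  have hex : ∃ b, n ≤ b ^ q := ⟨n, Nat.le_self_pow (by omega) n⟩
  have h0 : ¬ n ≤ 0 ^ q := by rw [zero_pow (by omega)]; omega
  have h1 : ¬ n ≤ 1 ^ q := by rw [one_pow]; omega
  have hb2 : 2 ≤ Nat.find hex := by
    by_contra h
    have := Nat.find_spec hex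
    interval_cases Nat.find hex <;> contradiction
  exact ⟨Nat.find hex, hb2, Nat.find_min' hex (Nat.le_self_pow (by omega) n), Nat.find_spec hex,
    not_le.1 (Nat.find_min hex (by omega))⟩

/-- Rounding the `q`-th root up costs at most a factor `2`, since `b ≤ 2 * (b - 1)`. The square is
needed because a scan occupies `F * Q` words, which is of order `b ^ 2`. -/
theorem sq_le_four_mul_rpow {n q b : ℕ} {δ : ℝ} (hn : 2 ≤ n) (hq : 2 ≤ q) (hδ : 2 / (q : ℝ) ≤ δ)
    (hb : 2 ≤ b) (hbn : (b - 1) ^ q < n) : ((b : ℝ)) ^ 2 ≤ 4 * (n : ℝ) ^ δ := by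
  have hn1 : (1 : ℝ) ≤ n := by exact_mod_cast (by omega : 1 ≤ n)
  have hq0 : (0 : ℝ) < q := by exact_mod_cast (by omega : 0 < q)
  have h1 : ((b - 1 : ℕ) : ℝ) ≤ (n : ℝ) ^ (1 / (q : ℝ)) := by
    have h2 : (((b - 1 : ℕ) : ℝ)) ^ (q : ℝ) ≤ n := by
      rw [Real.rpow_natCast]
      exact_mod_cast hbn.le
    have h3 := Real.rpow_le_rpow (by positivity) h2 (by positivity : (0 : ℝ) ≤ 1 / q)
    rwa [← Real.rpow_mul (by positivity), mul_one_div_cancel hq0.ne', Real.rpow_one] at h3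
  have h2 : (b : ℝ) ≤ 2 * (n : ℝ) ^ (1 / (q : ℝ)) := by
    have : (b : ℝ) ≤ 2 * ((b - 1 : ℕ) : ℝ) := by exact_mod_cast (by omega : b ≤ 2 * (b - 1))
    linarith
  calc (b : ℝ) ^ 2 ≤ (2 * (n : ℝ) ^ (1 / (q : ℝ))) ^ 2 := pow_le_pow_left₀ (by positivity) h2 2
    _ = 4 * (n : ℝ) ^ (2 / (q : ℝ)) := by
      rw [mul_pow, ← Real.rpow_natCast ((n : ℝ) ^ (1 / (q : ℝ))), ← Real.rpow_mul (by positivity)]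
      norm_num
      ring_nf
    _ ≤ 4 * (n : ℝ) ^ δ := by gcongr

/-- The parameters of the network for graphs with `n` vertices and `m` edges, where `b` is about the
`q`-th root of `n`. -/
theorem netParams_of_root {n m q k b : ℕ} (hn : 2 ≤ n) (hq : 2 ≤ q) (hk : 1 ≤ k) (hm : m ≤ n ^ 2)
    (hb : 2 ≤ b) (hbn : b ≤ n) (hnb : n ≤ b ^ q) :
    NetParams ((n + m) / b ^ 2 + 1) (b * (200 * q * k + 1)) b (4 * q)
      (2 * ((2 * (4 * q) + 2) * (200 * q * k + 1) + 18) * b ^ 2)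
      (((2 * (4 * q) + 2) * (200 * q * k + 1) + 19) * b ^ 2)
      ((n ^ (200 * q * k + 4 * q + k + 10)) ^ 32) (6 * b ^ 2) := by
  set a := 200 * q * k + 1 with ha
  set t := 200 * q * k + 4 * q + k + 10 with ht
  have hn1 : 1 ≤ n := by omega
  have htY : n ^ t ≤ (n ^ t) ^ 32 := Nat.le_self_pow (by norm_num) _
  have hpow : ∀ {x : ℕ}, x ≤ t → n ^ x ≤ (n ^ t) ^ 32 := fun hx =>
    (Nat.pow_le_pow_right hn1 hx).trans htY
  have hM : (n + m) / b ^ 2 + 1 ≤ n ^ 4 := by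
    have h1 : (n + m) / b ^ 2 ≤ n + m := Nat.div_le_self _ _
    have h2 : n ^ 2 * 4 ≤ n ^ 4 := by
      rw [show n ^ 4 = n ^ 2 * n ^ 2 by ring]
      exact Nat.mul_le_mul_left _ (by nlinarith)
    nlinarith
  have hb2 : b ^ 2 ≤ n ^ 2 := Nat.pow_le_pow_left hbn 2
  have h6 : 6 * b ^ 2 ≤ n ^ 5 := by
    have : n ^ 5 = n ^ 3 * n ^ 2 := by ring
    rw [this]
    exact Nat.mul_le_mul ((by norm_num : 6 ≤ 2 ^ 3).trans (Nat.pow_le_pow_left hn 3)) hb2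
  have hLt : 4 * q < n ^ (4 * q) := (Nat.lt_two_pow_self).trans_le (Nat.pow_le_pow_left hn _)
  have hat : a < n ^ a := (Nat.lt_two_pow_self).trans_le (Nat.pow_le_pow_left hn _)
  refine
    { machines_pos := Nat.succ_pos _
      fan_pos := by omega
      machines_le_pow := ?_
      depth_lt := hLt.trans_le (hpow (by omega))
      machines_le := hM.trans (hpow (by omega))
      counters_le := ?_
      three_le := ?_
      -- Scans take `(2 * L + 2) * a * b ^ 2` words. The data get this amount plus `19 * b ^ 2`, so
      -- that a packed full memory fits as well: half of the space is the same amount plus `18 * b ^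
      -- 2`, and one more word is at most `b ^ 2`. The `18` also equals three times the capacity
      -- constant `6`.
      space := le_of_eq_of_le (by ring)
        (Nat.mul_le_mul_right (b ^ 2) (by omega : 2 * ((2 * (4 * q) + 2) * a) + 19 ≤
          2 * ((2 * (4 * q) + 2) * a + 18)))
      cap_pos := by positivity
      three_cap_le := ?_
      cap_mul_lt := ?_
      counters_pos := by positivity }
  · calc (n + m) / b ^ 2 + 1 ≤ n ^ 4 := hM
      _ ≤ (b ^ q) ^ 4 := Nat.pow_le_pow_left hnb 4
      _ = b ^ (4 * q) := by rw [← pow_mul, mul_comm]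
  · calc b * a ≤ n * n ^ a := Nat.mul_le_mul hbn hat.le
      _ = n ^ (a + 1) := by ring
      _ ≤ _ := hpow (by omega)
  · calc 3 ≤ 2 ^ 2 := by norm_num
      _ ≤ n ^ 2 := Nat.pow_le_pow_left hn 2
      _ ≤ _ := hpow (by omega)
  · rw [← mul_assoc]
    exact Nat.mul_le_mul_right _ (by omega)
  · calc 6 * b ^ 2 * ((n + m) / b ^ 2 + 1) ≤ n ^ 5 * n ^ 4 := Nat.mul_le_mul h6 hM
      _ = n ^ 9 := by ring
      _ < n ^ 10 := Nat.pow_lt_pow_right (by omega) (by norm_num)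
      _ ≤ _ := hpow (by omega)

/-- For all constants `δ > 0` and `k` there are constants `C` (space), `R` (rounds), `c` (words have
`c * log n` bits) and a deterministic MPC algorithm, that is, a program for each number `n` of
vertices and `m` of edges, that handles every graph with IDs below `n ^ k`. -/
theorem mainTheorem6 (δ : ℝ) (hδ : 0 < δ) (k : ℕ) :
    ∃ (C R c : ℕ) (P : ℕ → ℕ → MPCProgram),
      ∀ G : FinGraph, G.NoIsolated → (∀ u ∈ G.verts, u < G.n ^ k) →
        ((P G.n G.m).space : ℝ) ≤ C * (G.n : ℝ) ^ δ ∧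
        G.n + G.m ≤ (P G.n G.m).globalSpace ∧
        (P G.n G.m).globalSpace ≤ C * (G.n + G.m) ∧
        ∀ init : Fin (P G.n G.m).machines → Multiset ℕ,
          (P G.n G.m).IsDistribution init G.encode →
          (P G.n G.m).Obeys init R (G.n ^ c) ∧
          ∃ H : FinGraph,
            ∑ i, (P G.n G.m).memory init R i = H.encode ∧
            G.IndependentContraction H ∧
            (H.n : ℝ) ≤ 99 / 100 * (G.n : ℝ) := by
  obtain ⟨q, hq2, hqδ⟩ : ∃ q : ℕ, 2 ≤ q ∧ 2 / (q : ℝ) ≤ δ := by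
    obtain ⟨q, hq⟩ := exists_nat_ge (2 / δ)
    refine ⟨q + 2, by omega, ?_⟩
    have h1 : (0 : ℝ) < ((q + 2 : ℕ) : ℝ) := by positivity
    rw [div_le_iff₀ h1]
    rw [div_le_iff₀ hδ] at hq
    push_cast
    nlinarith
  set K := 2 * ((2 * (4 * q) + 2) * (200 * q * k + 1) + 18) with hK
  set t := 200 * q * k + 4 * q + k + 10 with ht
  set R := contractionRounds (4 * q) (2 * k * q) with hR
  suffices hmain : ∀ n m : ℕ, ∃ P : MPCProgram, ∀ G : FinGraph, G.n = n → G.m = m → G.NoIsolated →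
      (∀ u ∈ G.verts, u < G.n ^ k) →
        (P.space : ℝ) ≤ (5 * K : ℕ) * (G.n : ℝ) ^ δ ∧
        G.n + G.m ≤ P.globalSpace ∧
        P.globalSpace ≤ 5 * K * (G.n + G.m) ∧
        ∀ init : Fin P.machines → Multiset ℕ,
          P.IsDistribution init G.encode →
          P.Obeys init R (G.n ^ (t * 32 * 8)) ∧
          ∃ H : FinGraph,
            ∑ i, P.memory init R i = H.encode ∧
            G.IndependentContraction H ∧
            (H.n : ℝ) ≤ 99 / 100 * (G.n : ℝ) by
    choose P hP using hmain
    exact ⟨5 * K, R, t * 32 * 8, P, fun G h1 h2 => hP G.n G.m G rfl rfl h1 h2⟩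
  intro n m
  -- An admissible graph forces the numerical facts used below: `m ≤ n ^ 2`, and for positive `n`
  -- also `2 ≤ n` and `1 ≤ k`. Without one, any program will do.
  by_cases hex : ∃ G : FinGraph, G.n = n ∧ G.m = m ∧ G.NoIsolated ∧ ∀ u ∈ G.verts, u < G.n ^ k
  swap
  · exact ⟨⟨0, 0, fun _ _ _ => 0⟩, fun G h1 h2 h3 h4 => absurd ⟨G, h1, h2, h3, h4⟩ hex⟩
  obtain ⟨G₀, hn₀, hm₀, hiso₀, hid₀⟩ := hex
  rcases Nat.eq_zero_or_pos n with rfl | hpos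
  · refine ⟨⟨0, 0, fun _ _ _ => 0⟩, fun G hn hm _ _ => ?_⟩
    have hm0 : G.m = 0 := by
      have := G.m_le
      rw [hn] at this
      simpa using this
    rw [hn, hm0]
    refine ⟨by simp; positivity, by simp, by simp [MPCProgram.globalSpace],
      fun init _ => ⟨⟨?_, ?_, ?_⟩, G, ?_, ⟨[], by simp, by simp, .nil G⟩, by simp [hn]⟩⟩
    · exact fun _ _ i => i.elim0
    · exact fun _ _ i => i.elim0
    · exact fun _ _ i => i.elim0
    · have h1 : G.encode = 0 := by
        rw [← Multiset.card_eq_zero, FinGraph.card_encode, hn, hm0]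
      rw [h1]
      rfl
  have hn2 : 2 ≤ n := by
    obtain ⟨u, hu⟩ : G₀.verts.Nonempty := by
      rw [← Finset.card_pos]
      exact lt_of_lt_of_eq hpos hn₀.symm
    obtain ⟨v, hv⟩ := hiso₀ u hu
    rw [← hn₀]
    exact Finset.one_lt_card.2 ⟨u, hu, v, G₀.support_subset _ _ hv.symm, hv.ne⟩
  have hk1 : 1 ≤ k := by
    by_contra hk0
    have hk0 : k = 0 := by omega
    subst hk0
    have h1 : G₀.verts ⊆ {0} := by
      intro u hu
      have := hid₀ u hu
      rw [pow_zero] at this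
      simp
      omega
    have h2 := Finset.card_le_card h1
    have h3 : G₀.verts.card = n := hn₀
    simp at h2
    omega
  obtain ⟨b, hb2, hbn, hnb, hbq⟩ := exists_root hn2 hq2
  have hmn : m ≤ n ^ 2 := by rw [← hm₀, ← hn₀]; exact G₀.m_le
  have p := netParams_of_root (k := k) hn2 hq2 hk1 hmn hb2 hbn hnb
  rw [← hK, ← ht] at p
  set M := (n + m) / b ^ 2 + 1 with hM
  set Q := b * (200 * q * k + 1) with hQ
  have hb1 : 1 ≤ b ^ 2 := Nat.one_le_pow _ _ (by omega)
  have hb4 : b ^ 2 ≤ 4 * n := by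
    have h1 : (b - 1) ^ 2 ≤ (b - 1) ^ q := Nat.pow_le_pow_right (by omega) hq2
    have h2 : b ^ 2 ≤ (2 * (b - 1)) ^ 2 := Nat.pow_le_pow_left (by omega) 2
    rw [mul_pow] at h2
    omega
  have hMlow : n + m ≤ b ^ 2 * M := (Nat.lt_mul_div_succ (n + m) (by omega)).le
  have hMup : b ^ 2 * M ≤ 5 * (n + m) := by
    have := Nat.mul_div_le (n + m) (b ^ 2)
    rw [hM, mul_add_one]
    omega
  -- Sorting keys are below the square of the ID bound, hence have at most `2 * k * q` digits in
  -- base `Q`, a number independent of `n`.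
  have hZQ : (n ^ k) ^ 2 ≤ Q ^ (2 * k * q) := by
    calc (n ^ k) ^ 2 ≤ ((b ^ q) ^ k) ^ 2 :=
          Nat.pow_le_pow_left (Nat.pow_le_pow_left hnb k) 2
      _ = b ^ (2 * k * q) := by rw [← pow_mul, ← pow_mul]; congr 1; ring
      _ ≤ Q ^ (2 * k * q) := Nat.pow_le_pow_left (Nat.le_mul_of_pos_right _ (by omega)) _
  -- The factor `200 * q * k + 1` in `Q` is chosen for this inequality, via `n ≤ b ^ q` and `b ≤ 2 ^
  -- b`; the `+ 1` makes it strict.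
  have hfam : (n ^ k) ^ 200 < 2 ^ Q := by
    calc (n ^ k) ^ 200 ≤ ((b ^ q) ^ k) ^ 200 :=
          Nat.pow_le_pow_left (Nat.pow_le_pow_left hnb k) 200
      _ = b ^ (200 * q * k) := by rw [← pow_mul, ← pow_mul]; congr 1; ring
      _ ≤ (2 ^ b) ^ (200 * q * k) := Nat.pow_le_pow_left Nat.lt_two_pow_self.le _
      _ = 2 ^ (b * (200 * q * k)) := by rw [← pow_mul]
      _ < 2 ^ Q := Nat.pow_lt_pow_right (by norm_num) (by rw [hQ, mul_add_one]; omega)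
  obtain ⟨h, hh⟩ := exists_hash_family hfam
  -- A scenario is an admissible graph of the given size together with an initial distribution, so
  -- the single program extracted below handles all of them.
  let Ω := {x : FinGraph × (Fin M → Multiset ℕ) // x.1.n = n ∧ x.1.m = m ∧ x.1.NoIsolated ∧
    (∀ u ∈ x.1.verts, u < n ^ k) ∧ ∑ i, x.2 i = x.1.encode ∧ ∀ i, (x.2 i).card ≤ K * b ^ 2}
  obtain ⟨D, hr, hD⟩ := contraction_reach (Ω := Ω) p (B := n ^ t) (Z := n ^ k) (P := 2 * k * q)
    (by
      have h1 : K * b ^ 2 / 2 = ((2 * (4 * q) + 2) * (200 * q * k + 1) + 18) * b ^ 2 := by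
        rw [hK, mul_assoc]
        exact Nat.mul_div_cancel_left _ (by norm_num)
      rw [h1, add_mul _ 19, add_mul _ 18]
      omega)
    (hn2.trans (Nat.le_self_pow (by omega) n)) (Nat.pow_le_pow_right hpos (by omega))
    (by
      calc Q ≤ n * n ^ (200 * q * k + 1) := Nat.mul_le_mul hbn
            ((Nat.lt_two_pow_self).le.trans (Nat.pow_le_pow_left hn2 _))
        _ = n ^ (200 * q * k + 2) := by ring
        _ ≤ n ^ t := Nat.pow_le_pow_right hpos (by omega))
    le_rfl hZQ h hh (fun ω => ω.1.1) (fun ω => ω.2.2.2.1) (fun ω => ω.2.2.2.2.1)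
    (fun ω => by
      rw [ω.2.1, ω.2.2.1, mul_assoc]
      exact Nat.mul_le_mul_left 6 hMlow)
    (fun ω => ω.1.2) (fun ω => ω.2.2.2.2.2.1) (fun ω => ω.2.2.2.2.2.2)
  obtain ⟨step, hstep⟩ := hr.realize
  refine ⟨⟨M, K * b ^ 2, step⟩, fun G hn hm hiso hid => ⟨?_, ?_, ?_, ?_⟩⟩
  · have h1 := sq_le_four_mul_rpow hn2 hq2 hqδ hb2 hbq
    have h2 : (0 : ℝ) ≤ (n : ℝ) ^ δ := by positivity
    rw [hn]
    push_cast
    calc (K : ℝ) * (b : ℝ) ^ 2 ≤ K * (5 * (n : ℝ) ^ δ) := by gcongr; linarith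
      _ = 5 * K * (n : ℝ) ^ δ := by ring
  · rw [hn, hm]
    refine hMlow.trans ?_
    show b ^ 2 * M ≤ K * b ^ 2 * M
    rw [mul_assoc]
    exact Nat.le_mul_of_pos_left _ (by omega)
  · rw [hn, hm]
    show K * b ^ 2 * M ≤ 5 * K * (n + m)
    calc K * b ^ 2 * M = K * (b ^ 2 * M) := by ring
      _ ≤ K * (5 * (n + m)) := Nat.mul_le_mul_left _ hMup
      _ = 5 * K * (n + m) := by ring
  · intro init hinit
    let ω : Ω := ⟨(G, init), hn, hm, hiso, by simpa only [hn] using hid, hinit.1, hinit.2⟩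
    obtain ⟨s1, s2, s3⟩ := hstep ω
    obtain ⟨H, hH1, hH2, hH3⟩ := hD ω
    have hWW : n ^ (t * 32 * 8) = ((n ^ t) ^ 32) ^ 8 := by
      rw [← pow_mul, ← pow_mul, mul_assoc]
    refine ⟨⟨s2, ?_, ?_⟩, H, ?_, hH2, ?_⟩
    · intro r hr i
      rcases Nat.eq_zero_or_pos r with rfl | hr0
      · exact hinit.2 i
      · exact (s3 r hr hr0 i).1
    · intro r hr i w hw
      rw [hn, hWW]
      rcases Nat.eq_zero_or_pos r with rfl | hr0
      · have hw' : w ∈ G.encode := by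
          rw [← hinit.1]
          exact Multiset.mem_sum.2 ⟨i, Finset.mem_univ _, hw⟩
        have h1 : w < (n ^ k) ^ 2 := by
          rw [← hn]
          rcases FinGraph.mem_encode.1 hw' with ⟨u, hu, rfl⟩ | ⟨u, v, huv, rfl⟩
          · exact pair_lt_sq (hid u hu) (hid u hu)
          · have h2 := hid u (G.support_subset _ _ huv)
            have h3 := hid v (G.support_subset _ _ huv.symm)
            exact pair_lt_sq (by omega) (by omega)
        refine h1.trans_le ?_
        rw [← hWW, ← pow_mul]
        exact Nat.pow_le_pow_right hpos (by omega)
      · exact (s3 r hr hr0 i).2 w hw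
    · rw [← hH1, ← s1]
    · have h1 : (100 * H.n : ℝ) ≤ 99 * G.n := by exact_mod_cast hH3
      linarith
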